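/- Let $\mathbb{K}$ be a field of characteristic zero, let $1\le k\le n$ be integers, and let $\lambda\vdash n$, $\mu\vdash k$ be partitions with $\mu_i\le\lambda_i$ for all $i$. Write $D_\lambda=\{(i,j):1\le j\le\lambda_i\}$ for the Young diagram of $\lambda$. Let $T:D_\lambda\to\{1,\dots,n\}$ be a Young tableau of shape $\lambda$, i.e. a bijection (not necessarily standard), and let $S=T|_{D_\mu}$ be its subtableau of shape $\mu$. Write $\mathfrak{S}_n$ for the group of permutations of $\{1,\dots,n\}$, with product $(\sigma\tau)(a)=\sigma(\tau(a))$. The Young symmetrizer of $T$ is the element $$\mathfrak{c}_\lambda(T)=\Big(\sum_{\sigma\in\mathcal{R}_T}\sigma\Big)\cdot\Big(\sum_{\tau\in\mathcal{C}_T}\mathrm{sgn}(\tau)\,\tau\Big)\in\mathbb{K}[\mathfrak{S}_n],$$ where $\mathcal{R}_T$ (resp. $\mathcal{C}_T$) is the group of permutations that map each row (resp. column) of $T$ to itself. The Young symmetrizer $\mathfrak{c}_\mu(S)\in\mathbb{K}[\mathfrak{S}_n]$ is defined in the same way from $S$, where permutations of the entries of $S$ are regarded as elements of $\mathfrak{S}_n$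 fixing all the other elements. Let $L(T;S)\subset\mathfrak{S}_n$ be the set of permutations $\sigma$ such that for every entry $s$ of $S$, either $\sigma(s)=s$ or $\sigma(s)$ lies in a column of $T$ strictly to the left of the column of $s$, and such that moreover, if $\sigma(s)=s$ for all entries $s$ of $S$, then $\sigma=\mathbb{1}$ is the identity. Let $\alpha_\mu=\prod_{(i,j)\in D_\mu}|H_{i,j}|$ be the product of the hook lengths of $\mu$, where $H_{i,j}=\{(i,j')\in D_\mu:j'\ge j\}\cup\{(i',j)\in D_\mu:i'\ge i\}$. Then there exist rational numbers $m_\sigma$, $\sigma\in L(T;S)$, such that $$\mathfrak{c}_\lambda(T)\cdot\mathfrak{c}_\mu(S)=\mathfrak{c}_\lambda(T)\cdot\Big(\sum_{\sigma\in L(T;S)}m_\sigma\cdot\sigma\Big),$$ $m_{\mathbb{1}}=\alpha_\mu$, and, for every $\sigma\in L(T;S)$, $m_\sigma\ge0$ if $\sigma$ is even and $m_\sigma\le0$ if $\sigma$ is odd. -/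

import Mathlib

/-- A Young tableau of shape `lam` with set of entries `A`: a bijection from the cells of the Young
diagram to `A`. A cell is a pair (row index, column index), both counted from `0`. -/
abbrev YoungTableau (lam : YoungDiagram) (A : Type*) := {c // c ∈ lam.cells} ≃ A

/-- A Young tableau of shape `mu` whose set of entries is a subset of `A` (the range of the map). -/
abbrev YoungTableauIn (mu : YoungDiagram) (A : Type*) := {c // c ∈ mu.cells} ↪ A

namespace YoungTableau

variable {A : Type*} {lam mu : YoungDiagram}

/-- The subtableau of shape `mu`: the restriction of `T` to the cells of `mu`. -/
def sub (T : YoungTableau lam A) (h : mu ≤ lam) : YoungTableauIn mu A where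
  toFun c := T ⟨c.1, h c.2⟩
  inj' c d hcd := Subtype.ext (by simpa using hcd)

/-- The index of the column of `T` that contains the entry `a`. -/
def col (T : YoungTableau lam A) (a : A) : ℕ := (T.symm a).1.2

end YoungTableau

namespace YoungTableauIn

variable {A : Type*} {mu : YoungDiagram}

/-- The set of entries in the `i`-th row. -/
def rowSet (S : YoungTableauIn mu A) (i : ℕ) : Set A := {a | ∃ c, c.1.1 = i ∧ S c = a}

/-- The set of entries in the `j`-th column. -/
def colSet (S : YoungTableauIn mu A) (j : ℕ) : Set A := {a | ∃ c, c.1.2 = j ∧ S c = a}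

/-- The row group: the permutations of `A` that fix every element which is not an entry of `S` and
map every row of `S` to itself. -/
def IsRowPerm (S : YoungTableauIn mu A) (σ : Equiv.Perm A) : Prop :=
  (∀ a, a ∉ Set.range S → σ a = a) ∧ ∀ i, ∀ a ∈ S.rowSet i, σ a ∈ S.rowSet i

/-- The column group: the permutations of `A` that fix every element which is not an entry of `S`
and map every column of `S` to itself. -/
def IsColPerm (S : YoungTableauIn mu A) (σ : Equiv.Perm A) : Prop :=
  (∀ a, a ∉ Set.range S → σ a = a) ∧ ∀ j, ∀ a ∈ S.colSet j, σ a ∈ S.colSet j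

variable (K : Type*) [Field K] [Fintype A] [DecidableEq A]

open Classical in
/-- The row symmetrizer: the sum of the row group of `S`. -/
noncomputable def rowSymmetrizer (S : YoungTableauIn mu A) : MonoidAlgebra K (Equiv.Perm A) :=
  ∑ σ : Equiv.Perm A with S.IsRowPerm σ, MonoidAlgebra.single σ 1

open Classical in
/-- The column antisymmetrizer: the signed sum of the column group of `S`. -/
noncomputable def colAntisymmetrizer (S : YoungTableauIn mu A) :
    MonoidAlgebra K (Equiv.Perm A) :=
  ∑ τ : Equiv.Perm A with S.IsColPerm τ,
    MonoidAlgebra.single τ (((Equiv.Perm.sign τ : ℤ) : K))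

/-- The Young symmetrizer of `S` in `K[𝔖_A]`. -/
noncomputable def youngSymmetrizer (S : YoungTableauIn mu A) : MonoidAlgebra K (Equiv.Perm A) :=
  S.rowSymmetrizer K * S.colAntisymmetrizer K

end YoungTableauIn

namespace YoungDiagram

/-- The hook of `mu` at the cell `c`: the cells of `mu` weakly to the right of `c` in its row and
weakly below `c` in its column. -/
def hook (mu : YoungDiagram) (c : ℕ × ℕ) : Finset (ℕ × ℕ) :=
  mu.cells.filter fun d => (d.1 = c.1 ∧ c.2 ≤ d.2) ∨ (d.2 = c.2 ∧ c.1 ≤ d.1)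

/-- The product of all hook lengths of `mu`. -/
def hookProd (mu : YoungDiagram) : ℕ := ∏ c ∈ mu.cells, (mu.hook c).card

end YoungDiagram

/-- The set `L(T;S)`: the permutations `σ` that send each entry `s` of `S` either to itself or to an
entry of `T` in a column strictly to the left of the column of `s`, and that are the identity if
they fix all entries of `S`. -/
def leftPerms {A : Type*} {lam mu : YoungDiagram} (T : YoungTableau lam A)
    (S : YoungTableauIn mu A) : Set (Equiv.Perm A) :=
  {σ | (∀ s ∈ Set.range S, σ s = s ∨ T.col (σ s) < T.col s) ∧
    ((∀ s ∈ Set.range S, σ s = s) → σ = 1)}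

/-!
# Products of Young symmetrizers

All identities are proved in the group algebra over `ℚ` and then transported along `ℚ → K`. Let `c`
be the Young symmetrizer of `T`, let `E` be the set of entries of `S`, and let `Z` be the sum of
the transpositions of ordered pairs of distinct elements of `E`.

The element `c` satisfies the *Garnir relations* (`IsGarnir`): right multiplication by
transpositions within a column changes its sign, and the sum of the products of `c` with the
transpositions that exchange a fixed entry with the entries of a fixed column further to the left
is `c` again. Now read `c * σ` as the configuration in which the entry `s` sits at the position
`σ s`. The Garnir relations show that `c * σ * Z` is a scalar multiple `w σ` of `c * σ`, minus
twice the sum of all configurations obtained by moving one entry of `S` to a position in a column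
further to the left that is not occupied by an entry of `S` (`IsGarnir.mul_of_mul_transSum`). These
moves stay in `leftPerms`, are transpositions, and `w σ < w 1` for `σ ≠ 1` in `leftPerms`
(`IsLeft.weight_lt`). Hence the triangular linear system expressing that `X = c * ∑ m_σ σ` is an
eigenvector of `Z` with eigenvalue `w 1` has a unique solution with `m_1 = 1` supported on
`leftPerms`, and its recursion shows that `m_σ` has the sign of `σ`
(`coef`, `sign_mul_coef_nonneg`).

It remains to compare `X` with `c * c_μ(S)`, where `c_μ(S)` is the Young symmetrizer of `S`.
* The eigenvalue `w 1` is extreme: with respect to the inner product for which the permutations are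
  orthonormal, the operators whose vanishing expresses the Garnir relations for `S` are positive
  on column-alternating vectors, and `w 1 - Z` is twice their sum. So `X` satisfies the Garnir
  relations for `S` (`IsColAlt.isGarnir`).
* Every such vector is multiplied by `c_μ(S)` by the product of the hook lengths
  (`IsGarnir.mul_rowSum_mul_colSum`). This is proved by adding the cells of `S` to the row
  symmetrizer one by one; the cell `x` contributes the factor `(arm + leg + 1) / (leg + 1)`, and
  the denominators multiply to the order of the column group.
* If `σ ≠ 1` is in `leftPerms`, then `c * σ * c_μ(S) = 0`, because `σ` sends two entries of some
  row of `S` to one column of `T` (`IsGarnir.mul_of_mul_rowSum_eq_zero`).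

Hence `c * c_μ(S) = X * c_μ(S)` is `X` times the product of the hook lengths.
-/

set_option linter.unusedSectionVars false

namespace YoungProduct

open Equiv (swap Perm)

variable {A ι : Type*} [Fintype A] [DecidableEq A] [DecidableEq ι]

/-- The permutations as elements of the rational group algebra. -/
local notation "δ" => MonoidAlgebra.of ℚ (Perm _)

/-! ### Character sums over label-preserving permutations -/

/-- The permutations of `A` that fix every element outside `E` and preserve the labelling `f`.
Row groups and column groups of tableaux are of this form, with `f` the row or column index. -/
def labelPerms (f : A → ι) (E : Finset A) : Finset (Perm A) :=
  Finset.univ.filter fun σ => (∀ a, a ∉ E → σ a = a) ∧ ∀ a, f (σ a) = f a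

theorem mem_labelPerms {f : A → ι} {E : Finset A} {σ : Perm A} :
    σ ∈ labelPerms f E ↔ (∀ a, a ∉ E → σ a = a) ∧ ∀ a, f (σ a) = f a := by
  simp [labelPerms]

theorem mul_mem_labelPerms {f : A → ι} {E : Finset A} {σ τ : Perm A}
    (hσ : σ ∈ labelPerms f E) (hτ : τ ∈ labelPerms f E) : σ * τ ∈ labelPerms f E := by
  rw [mem_labelPerms] at *
  refine ⟨fun a ha => ?_, fun a => ?_⟩
  · rw [Perm.mul_apply, hτ.1 a ha, hσ.1 a ha]
  · rw [Perm.mul_apply, hσ.2, hτ.2]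

theorem inv_mem_labelPerms {f : A → ι} {E : Finset A} {σ : Perm A}
    (hσ : σ ∈ labelPerms f E) : σ⁻¹ ∈ labelPerms f E := by
  rw [mem_labelPerms] at *
  refine ⟨fun a ha => ?_, fun a => ?_⟩
  · rw [Perm.inv_eq_iff_eq, hσ.1 a ha]
  · have := hσ.2 (σ⁻¹ a)
    rw [← Perm.mul_apply, mul_inv_cancel, Perm.one_apply] at this
    exact this.symm

theorem swap_mem_labelPerms {f : A → ι} {E : Finset A} {x y : A} (hx : x ∈ E) (hy : y ∈ E)
    (h : f x = f y) : swap x y ∈ labelPerms f E := by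
  rw [mem_labelPerms]
  refine ⟨fun a ha => Equiv.swap_apply_of_ne_of_ne ?_ ?_, fun a => ?_⟩
  · rintro rfl; exact ha hx
  · rintro rfl; exact ha hy
  · rw [Equiv.swap_apply_def]
    split_ifs with h1 h2
    · rw [h1, h]
    · rw [h2, h]
    · rfl

theorem one_mem_labelPerms (f : A → ι) (E : Finset A) : 1 ∈ labelPerms f E := by
  simp [mem_labelPerms]

theorem apply_mem_of_mem_labelPerms {f : A → ι} {E : Finset A} {σ : Perm A}
    (hσ : σ ∈ labelPerms f E) {a : A} (ha : a ∈ E) : σ a ∈ E := by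
  by_contra h
  have := (mem_labelPerms.1 hσ).1 _ h
  rw [σ.injective this] at h
  exact h ha

/-- A label-preserving permutation of `insert e E` is uniquely a transposition moving `e` to its
image, times a label-preserving permutation of `E`. -/
theorem sum_labelPerms_insert {M : Type*} [AddCommMonoid M] (f : A → ι) {E : Finset A} {e : A}
    (he : e ∉ E) (F : Perm A → M) :
    ∑ σ ∈ labelPerms f (insert e E), F σ =
      ∑ y ∈ insert e E with f y = f e, ∑ τ ∈ labelPerms f E, F (swap e y * τ) := by
  have hsub : labelPerms f E ⊆ labelPerms f (insert e E) := fun σ hσ => by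
    rw [mem_labelPerms] at *
    exact ⟨fun a ha => hσ.1 a fun h => ha (Finset.mem_insert_of_mem h), hσ.2⟩
  rw [← Finset.sum_product']
  refine Finset.sum_bij' (fun σ _ => (σ e, swap e (σ e) * σ)) (fun p _ => swap e p.1 * p.2)
    ?_ ?_ ?_ ?_ ?_
  · intro σ hσ
    have hm := apply_mem_of_mem_labelPerms hσ (Finset.mem_insert_self e E)
    have hl := (mem_labelPerms.1 hσ).2 e
    have hs : swap e (σ e) * σ ∈ labelPerms f (insert e E) :=
      mul_mem_labelPerms (swap_mem_labelPerms (Finset.mem_insert_self e E) hm hl.symm) hσ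
    rw [Finset.mem_product, Finset.mem_filter]
    refine ⟨⟨hm, hl⟩, mem_labelPerms.2 ⟨fun a ha => ?_, (mem_labelPerms.1 hs).2⟩⟩
    by_cases hae : a = e
    · subst hae; simp
    · exact (mem_labelPerms.1 hs).1 a (by simp [hae, ha])
  · rintro ⟨y, τ⟩ h
    rw [Finset.mem_product, Finset.mem_filter] at h
    exact mul_mem_labelPerms
      (swap_mem_labelPerms (Finset.mem_insert_self e E) h.1.1 h.1.2.symm) (hsub h.2)
  · intro σ _
    simp [← mul_assoc]
  · rintro ⟨y, τ⟩ h
    rw [Finset.mem_product, Finset.mem_filter] at h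
    have := (mem_labelPerms.1 h.2).1 e he
    simp [this, ← mul_assoc]
  · intro σ _
    simp [← mul_assoc]

/-- The sum of `χ σ • σ` over the label-preserving permutations of `E`. For trivial `χ` this is a
row symmetrizer, for `χ = sign` a column antisymmetrizer. -/
noncomputable def charSum (χ : Perm A →* ℤˣ) (f : A → ι) (E : Finset A) :
    MonoidAlgebra ℚ (Perm A) :=
  ∑ σ ∈ labelPerms f E, ((χ σ : ℤ) : ℚ) • δ σ

theorem charSum_empty (χ : Perm A →* ℤˣ) (f : A → ι) : charSum χ f ∅ = 1 := by
  have : labelPerms f (∅ : Finset A) = {1} := by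
    ext σ
    rw [mem_labelPerms, Finset.mem_singleton]
    constructor
    · intro h; ext a; exact h.1 a (by simp)
    · rintro rfl; simp
  rw [charSum, this, Finset.sum_singleton, map_one, map_one]
  simp

/-- Left absorption. -/
theorem of_mul_charSum (χ : Perm A →* ℤˣ) (f : A → ι) (E : Finset A) {τ : Perm A}
    (hτ : τ ∈ labelPerms f E) :
    δ τ * charSum χ f E = ((χ τ : ℤ) : ℚ) • charSum χ f E := by
  rw [charSum, Finset.mul_sum, Finset.smul_sum]
  refine Finset.sum_bij (fun σ _ => τ * σ) (fun σ hσ => mul_mem_labelPerms hτ hσ)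
    (fun _ _ _ _ h => mul_left_cancel h)
    (fun σ hσ => ⟨τ⁻¹ * σ, mul_mem_labelPerms (inv_mem_labelPerms hτ) hσ, by simp⟩) ?_
  intro σ _
  rw [mul_smul_comm, ← map_mul, smul_smul, map_mul χ]
  congr 1
  push_cast
  rcases Int.units_eq_one_or (χ τ) with h | h <;> simp [h]

/-- Right absorption. -/
theorem charSum_mul_of (χ : Perm A →* ℤˣ) (f : A → ι) (E : Finset A) {τ : Perm A}
    (hτ : τ ∈ labelPerms f E) :
    charSum χ f E * δ τ = ((χ τ : ℤ) : ℚ) • charSum χ f E := by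
  rw [charSum, Finset.sum_mul, Finset.smul_sum]
  refine Finset.sum_bij (fun σ _ => σ * τ) (fun σ hσ => mul_mem_labelPerms hσ hτ)
    (fun _ _ _ _ h => mul_right_cancel h)
    (fun σ hσ => ⟨σ * τ⁻¹, mul_mem_labelPerms hσ (inv_mem_labelPerms hτ), by simp⟩) ?_
  intro σ _
  rw [smul_mul_assoc, ← map_mul, smul_smul, map_mul χ]
  congr 1
  push_cast
  rcases Int.units_eq_one_or (χ τ) with h | h <;> simp [h]

theorem charSum_insert (χ : Perm A →* ℤˣ) (f : A → ι) {E : Finset A} {e : A} (he : e ∉ E) :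
    charSum χ f (insert e E) =
      (1 + ∑ y ∈ E with f y = f e, ((χ (swap e y) : ℤ) : ℚ) • δ (swap e y)) * charSum χ f E := by
  have hy : (insert e E).filter (fun y => f y = f e) = insert e (E.filter fun y => f y = f e) := by
    rw [Finset.filter_insert, if_pos rfl]
  rw [charSum, sum_labelPerms_insert f he, hy, Finset.sum_insert (by simp [he]), add_mul, one_mul,
    Finset.sum_mul]
  congr 1
  · simp only [Equiv.swap_self, ← Perm.one_def, one_mul, charSum]
  · refine Finset.sum_congr rfl fun y _ => ?_
    rw [charSum, Finset.mul_sum]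
    refine Finset.sum_congr rfl fun τ _ => ?_
    rw [smul_mul_smul_comm, ← map_mul, map_mul χ]
    push_cast
    rfl

theorem sum_labelPerms_inv {M : Type*} [AddCommMonoid M] (f : A → ι) (E : Finset A)
    (F : Perm A → M) : ∑ σ ∈ labelPerms f E, F σ⁻¹ = ∑ σ ∈ labelPerms f E, F σ :=
  Finset.sum_bij (fun σ _ => σ⁻¹) (fun _ h => inv_mem_labelPerms h)
    (fun _ _ _ _ h => inv_injective h) (fun σ h => ⟨σ⁻¹, inv_mem_labelPerms h, inv_inv σ⟩)
    (fun _ _ => rfl)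

theorem charSum_insert' (χ : Perm A →* ℤˣ) (f : A → ι) {E : Finset A} {e : A} (he : e ∉ E) :
    charSum χ f (insert e E) =
      charSum χ f E * (1 + ∑ y ∈ E with f y = f e, ((χ (swap e y) : ℤ) : ℚ) • δ (swap e y)) := by
  have hy : (insert e E).filter (fun y => f y = f e) = insert e (E.filter fun y => f y = f e) := by
    rw [Finset.filter_insert, if_pos rfl]
  rw [charSum, ← sum_labelPerms_inv, sum_labelPerms_insert f he, hy,
    Finset.sum_insert (by simp [he]), mul_add, mul_one, Finset.mul_sum]
  congr 1
  · simp only [Equiv.swap_self, ← Perm.one_def, one_mul]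
    exact sum_labelPerms_inv f E fun σ => ((χ σ : ℤ) : ℚ) • δ σ
  · refine Finset.sum_congr rfl fun y _ => ?_
    rw [charSum, ← sum_labelPerms_inv f E, Finset.sum_mul]
    refine Finset.sum_congr rfl fun τ _ => ?_
    rw [smul_mul_smul_comm, ← map_mul, mul_inv_rev, Equiv.swap_inv, map_mul χ]
    push_cast
    rfl

/-- A permutation moving only elements outside `E` commutes with the sums over `E`. -/
theorem of_swap_mul_charSum_comm (χ : Perm A →* ℤˣ) (f : A → ι) {E : Finset A} {x z : A}
    (hx : x ∉ E) (hz : z ∉ E) :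
    δ (swap x z) * charSum χ f E = charSum χ f E * δ (swap x z) := by
  rw [charSum, Finset.mul_sum, Finset.sum_mul]
  refine Finset.sum_congr rfl fun σ hσ => ?_
  have h := (mem_labelPerms.1 hσ).1
  rw [mul_smul_comm, smul_mul_assoc, ← map_mul, ← map_mul, Equiv.mul_swap_eq_swap_mul, h x hx,
    h z hz]

/-- A vector on which the label-preserving permutations of `E` act by the character `χ` is
multiplied by the order of their group. -/
theorem mul_charSum_of_forall (χ : Perm A →* ℤˣ) (f : A → ι) (E : Finset A)
    (v : MonoidAlgebra ℚ (Perm A))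
    (hv : ∀ σ ∈ labelPerms f E, v * δ σ = ((χ σ : ℤ) : ℚ) • v) :
    v * charSum χ f E = ((labelPerms f E).card : ℚ) • v := by
  rw [charSum, Finset.mul_sum]
  rw [Finset.sum_congr rfl (g := fun _ => v), Finset.sum_const, Nat.cast_smul_eq_nsmul]
  intro σ hσ
  rw [mul_smul_comm, hv σ hσ, smul_smul]
  rcases Int.units_eq_one_or (χ σ) with h | h <;> simp [h]

/-! ### Column antisymmetry and the Garnir relations -/

/-- The set `E`, placed in the quarter plane by `cell`, fills a Young diagram. -/
def IsDiagram (cell : A → ℕ × ℕ) (E : Finset A) : Prop :=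
  ∀ a ∈ E, ∀ i ≤ (cell a).1, ∀ j ≤ (cell a).2, ∃ b ∈ E, cell b = (i, j)

/-- The row symmetrizer of the entries in `E`, over `ℚ`. -/
noncomputable def rowSum (cell : A → ℕ × ℕ) (E : Finset A) : MonoidAlgebra ℚ (Perm A) :=
  charSum 1 (fun a => (cell a).1) E

/-- The column antisymmetrizer of the entries in `E`, over `ℚ`. -/
noncomputable def colSum (cell : A → ℕ × ℕ) (E : Finset A) : MonoidAlgebra ℚ (Perm A) :=
  charSum Perm.sign (fun a => (cell a).2) E

/-- Right multiplication by transpositions inside a column of `E` changes the sign of `v`. -/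
def IsColAlt (cell : A → ℕ × ℕ) (E : Finset A) (v : MonoidAlgebra ℚ (Perm A)) : Prop :=
  ∀ x ∈ E, ∀ y ∈ E, x ≠ y → (cell x).2 = (cell y).2 → v * δ (swap x y) = -v

/-- The relations of the polytabloids under right multiplication: `v` alternates along the columns
of `E`, and exchanging an entry with all the entries of a column further to the left, one at a
time, gives `v` back. -/
structure IsGarnir (cell : A → ℕ × ℕ) (E : Finset A) (v : MonoidAlgebra ℚ (Perm A)) : Prop where
  alt : IsColAlt cell E v
  garnir : ∀ y ∈ E, ∀ t < (cell y).2, v * ∑ z ∈ E with (cell z).2 = t, δ (swap y z) = v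

theorem rowSum_mul_swap (cell : A → ℕ × ℕ) {E : Finset A} {x y : A} (hx : x ∈ E) (hy : y ∈ E)
    (h : (cell x).1 = (cell y).1) : rowSum cell E * δ (swap x y) = rowSum cell E := by
  rw [rowSum, charSum_mul_of _ _ _ (swap_mem_labelPerms hx hy h)]
  simp

theorem swap_mul_rowSum (cell : A → ℕ × ℕ) {E : Finset A} {x y : A} (hx : x ∈ E) (hy : y ∈ E)
    (h : (cell x).1 = (cell y).1) : δ (swap x y) * rowSum cell E = rowSum cell E := by
  rw [rowSum, of_mul_charSum _ _ _ (swap_mem_labelPerms hx hy h)]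
  simp

theorem colSum_mul_swap (cell : A → ℕ × ℕ) {E : Finset A} {x y : A} (hx : x ∈ E) (hy : y ∈ E)
    (hxy : x ≠ y) (h : (cell x).2 = (cell y).2) :
    colSum cell E * δ (swap x y) = -colSum cell E := by
  rw [colSum, charSum_mul_of _ _ _ (swap_mem_labelPerms hx hy h), Perm.sign_swap hxy]
  simp

theorem swap_mul_colSum (cell : A → ℕ × ℕ) {E : Finset A} {x y : A} (hx : x ∈ E) (hy : y ∈ E)
    (hxy : x ≠ y) (h : (cell x).2 = (cell y).2) :
    δ (swap x y) * colSum cell E = -colSum cell E := by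
  rw [colSum, of_mul_charSum _ _ _ (swap_mem_labelPerms hx hy h), Perm.sign_swap hxy]
  simp

theorem eq_zero_of_eq_neg {M : Type*} [AddCommGroup M] [Module ℚ M] {v : M} (h : v = -v) :
    v = 0 := by
  have h2 : (2 : ℚ) • v = 0 := by
    rw [two_smul]
    nth_rewrite 1 [h]
    exact neg_add_cancel v
  exact (smul_eq_zero.1 h2).resolve_left two_ne_zero

/-- The Young symmetrizer satisfies the Garnir relations. For a column `t` and an entry `y` to its
right, every column permutation `τ` leaves some entry of column `t` in the row of `τ y`, so the row
symmetrizer kills `τ` times the antisymmetrizer of column `t` enlarged by `y`. -/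
theorem isGarnir_rowSum_mul_colSum {cell : A → ℕ × ℕ} (hd : IsDiagram cell Finset.univ) :
    IsGarnir cell Finset.univ (rowSum cell Finset.univ * colSum cell Finset.univ) := by
  refine ⟨fun x hx y hy hxy h => ?_, fun y _ t ht => ?_⟩
  · rw [mul_assoc, colSum_mul_swap cell hx hy hxy h, mul_neg]
  set a := rowSum cell (Finset.univ : Finset A)
  set b := colSum cell (Finset.univ : Finset A) with hb
  set D : Finset A := Finset.univ.filter fun z => (cell z).2 = t
  have hD : ∀ z, z ∈ D ↔ (cell z).2 = t := fun z => by simp [D]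
  have hyD : y ∉ D := by rw [hD]; omega
  let f : A → ℕ := fun z => if z = y then t else (cell z).2
  have hfy : f y = t := if_pos rfl
  have hfD : ∀ z ∈ D, f z = t := fun z hz => by
    have : z ≠ y := by rintro rfl; exact hyD hz
    simp only [f, if_neg this, (hD z).1 hz]
  have hfl : D.filter (fun z => f z = f y) = D :=
    Finset.filter_true_of_mem fun z hz => by rw [hfD z hz, hfy]
  set G := charSum Perm.sign f (insert y D) with hG
  have hGe : G = charSum Perm.sign f D * (1 - ∑ z ∈ D, δ (swap y z)) := by
    rw [hG, charSum_insert' _ _ hyD, hfl, sub_eq_add_neg, ← Finset.sum_neg_distrib]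
    congr 2
    refine Finset.sum_congr rfl fun z hz => ?_
    have : y ≠ z := by rintro rfl; exact hyD hz
    rw [Perm.sign_swap this]
    simp
  have hbA : b * charSum Perm.sign f D = ((labelPerms f D).card : ℚ) • b := by
    refine mul_charSum_of_forall _ _ _ _ fun σ hσ => charSum_mul_of _ _ _ ?_
    refine mem_labelPerms.2 ⟨fun a ha => absurd (Finset.mem_univ a) ha, fun c => ?_⟩
    by_cases hc : c ∈ D
    · rw [(hD _).1 hc, (hD _).1 (apply_mem_of_mem_labelPerms hσ hc)]
    · rw [(mem_labelPerms.1 hσ).1 c hc]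
  have hkill : ∀ τ ∈ labelPerms (fun c => (cell c).2) (Finset.univ : Finset A),
      a * δ τ * G = 0 := by
    intro τ hτ
    have hτc := (mem_labelPerms.1 hτ).2
    obtain ⟨u, -, hu⟩ := hd (τ y) (Finset.mem_univ _) (cell (τ y)).1 le_rfl t
      (by rw [hτc]; exact ht.le)
    obtain ⟨z, rfl⟩ := τ.surjective u
    have hz : z ∈ D := by rw [hD, ← hτc z, hu]
    have hyz : y ≠ z := by rintro rfl; exact hyD hz
    apply eq_zero_of_eq_neg
    calc a * δ τ * G = a * δ (swap (τ y) (τ z)) * δ τ * G := by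
          rw [rowSum_mul_swap cell (Finset.mem_univ _) (Finset.mem_univ _)]
          rw [hu]
      _ = a * δ τ * (δ (swap y z) * G) := by
          rw [mul_assoc a, ← map_mul, ← Equiv.mul_swap_eq_swap_mul, map_mul]
          simp only [mul_assoc]
      _ = -(a * δ τ * G) := by
          rw [hG, of_mul_charSum _ _ _ (swap_mem_labelPerms (Finset.mem_insert_self _ _)
            (Finset.mem_insert_of_mem hz) (by rw [hfy, hfD z hz])), Perm.sign_swap hyz]
          simp
  have h0 : a * b * G = 0 := by
    rw [hb, colSum, charSum, Finset.mul_sum, Finset.sum_mul]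
    refine Finset.sum_eq_zero fun τ hτ => ?_
    rw [mul_smul_comm, smul_mul_assoc, hkill τ hτ, smul_zero]
  rw [hGe, ← mul_assoc, mul_assoc a, hbA, mul_smul_comm, smul_mul_assoc] at h0
  have h1 := (smul_eq_zero.1 h0).resolve_left
    (Nat.cast_ne_zero.2 (Finset.card_ne_zero_of_mem (one_mem_labelPerms f D)))
  rw [mul_sub, mul_one, sub_eq_zero] at h1
  exact h1.symm

/-! ### The product of hook lengths -/

/-- The entries of `E` to the right of `x` in its row. -/
def arm (cell : A → ℕ × ℕ) (E : Finset A) (x : A) : Finset A :=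
  E.filter fun y => (cell y).1 = (cell x).1 ∧ (cell x).2 < (cell y).2

/-- The entries of `E` below `x` in its column. -/
def leg (cell : A → ℕ × ℕ) (E : Finset A) (x : A) : Finset A :=
  E.filter fun y => (cell y).2 = (cell x).2 ∧ (cell x).1 < (cell y).1

/-- Adding one cell `x` to the row symmetrizer. A transposition of `x` with an entry `y` of its arm
is rewritten by the Garnir relation exchanging `y` with the column of `x`. The exchange with `x`
gives the main term; those with entries above `x` vanish by the symmetry of the rows of `F`; each
of those with entries in the leg of `x`, which `F` avoids, gives back the negative of the original
term. -/
theorem IsGarnir.mul_rowSum_insert_mul_colSum {cell : A → ℕ × ℕ} (hc : Function.Injective cell)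
    {E F : Finset A} (hd : IsDiagram cell E) {v : MonoidAlgebra ℚ (Perm A)}
    (hv : IsGarnir cell E v) {x : A} (hx : x ∈ E)
    (hF : ∀ y, y ∈ F ↔ y ∈ E ∧ ((cell x).2 < (cell y).2 ∨
      (cell y).2 = (cell x).2 ∧ (cell y).1 < (cell x).1)) :
    (((leg cell E x).card : ℚ) + 1) • (v * rowSum cell (insert x F) * colSum cell E) =
      (((leg cell E x).card : ℚ) + (arm cell E x).card + 1) •
        (v * rowSum cell F * colSum cell E) := by
  have hxF : x ∉ F := by rw [hF]; omega
  set W := rowSum cell F with hW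
  set b := colSum cell E with hb
  have hfl : F.filter (fun y => (cell y).1 = (cell x).1) = arm cell E x := by
    ext y
    simp only [Finset.mem_filter, hF, arm]
    constructor
    · rintro ⟨⟨h1, h2⟩, h3⟩; exact ⟨h1, h3, by omega⟩
    · rintro ⟨h1, h2, h3⟩; exact ⟨⟨h1, Or.inl h3⟩, h2⟩
  have hins : rowSum cell (insert x F) = (1 + ∑ y ∈ arm cell E x, δ (swap x y)) * W := by
    rw [rowSum, charSum_insert _ _ hxF, hfl, hW, rowSum]
    simp
  -- Each transposition of `x` with an entry `y` of its arm contributes the same multiple.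
  have key : ∀ y ∈ arm cell E x,
      (((leg cell E x).card : ℚ) + 1) • (v * δ (swap x y) * W * b) = v * W * b := by
    intro y hy
    obtain ⟨hyE, hyr, hyc⟩ := Finset.mem_filter.1 hy
    have hyx : y ≠ x := by rintro rfl; omega
    set D := E.filter fun z => (cell z).2 = (cell x).2 with hD
    have hterm : ∀ z ∈ D, v * δ (swap y z) * δ (swap x y) * W * b =
        (if z = x then v * W * b else 0) +
          (if (cell x).1 < (cell z).1 then -(v * δ (swap x y) * W * b) else 0) := by
      intro z hz
      obtain ⟨hzE, hzc⟩ := Finset.mem_filter.1 hz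
      have hyz : y ≠ z := by rintro rfl; omega
      rcases lt_trichotomy (cell z).1 (cell x).1 with h | h | h
      · -- The entry `u` in the row of `z` and the column of `y` is symmetrized with `z` by `W`.
        have hzx : z ≠ x := by rintro rfl; omega
        rw [if_neg hzx, if_neg (by omega), add_zero]
        obtain ⟨u, huE, hu⟩ := hd y hyE (cell z).1 (by omega) (cell y).2 le_rfl
        have hur : (cell u).1 = (cell z).1 := by rw [hu]
        have huc : (cell u).2 = (cell y).2 := by rw [hu]
        have hzF : z ∈ F := (hF z).2 ⟨hzE, Or.inr ⟨hzc, h⟩⟩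
        have huF : u ∈ F := (hF u).2 ⟨huE, Or.inl (by omega)⟩
        have hux : u ≠ x := by rintro rfl; omega
        have huy : u ≠ y := by rintro rfl; omega
        have huz : u ≠ z := by rintro rfl; omega
        apply eq_zero_of_eq_neg
        have hperm : swap y z * swap x y * swap z u = swap y u * (swap y z * swap x y) := by
          rw [Equiv.mul_swap_eq_swap_mul]
          congr 2
          · rw [Perm.mul_apply, Equiv.swap_apply_of_ne_of_ne hzx hyz.symm,
              Equiv.swap_apply_right]
          · rw [Perm.mul_apply, Equiv.swap_apply_of_ne_of_ne hux huy,
              Equiv.swap_apply_of_ne_of_ne huy huz]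
        calc v * δ (swap y z) * δ (swap x y) * W * b
            = v * δ (swap y z * swap x y * swap z u) * W * b := by
              nth_rewrite 1 [hW, ← swap_mul_rowSum cell hzF huF hur.symm]
              simp only [map_mul, mul_assoc]; rfl
          _ = v * δ (swap y u) * δ (swap y z) * δ (swap x y) * W * b := by
              rw [hperm]; simp only [map_mul, mul_assoc]
          _ = -(v * δ (swap y z) * δ (swap x y) * W * b) := by
              rw [hv.alt y hyE u huE huy.symm huc.symm]
              simp only [neg_mul]
      · have hzx : z = x := hc (Prod.ext h hzc)
        subst hzx
        rw [if_pos rfl, if_neg (lt_irrefl _), add_zero, mul_assoc v, ← map_mul,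
          Equiv.swap_comm y z, Equiv.swap_mul_self, map_one, mul_one]
      · have hzx : z ≠ x := by rintro rfl; omega
        rw [if_neg hzx, if_pos h, zero_add]
        have hzF : z ∉ F := by rw [hF]; omega
        have hperm : swap y z * swap x y = swap x y * swap x z := by
          rw [Equiv.mul_swap_eq_swap_mul (swap x y), Equiv.swap_apply_left,
            Equiv.swap_apply_of_ne_of_ne hzx hyz.symm]
        rw [mul_assoc v, ← map_mul, hperm, map_mul, ← mul_assoc v, mul_assoc _ _ W, hW, rowSum,
          of_swap_mul_charSum_comm _ _ hxF hzF, ← mul_assoc, mul_assoc _ _ b, hb,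
          swap_mul_colSum cell hx hzE hzx.symm hzc.symm, mul_neg]
    have hxD : x ∈ D := Finset.mem_filter.2 ⟨hx, rfl⟩
    have hleg : D.filter (fun z => (cell x).1 < (cell z).1) = leg cell E x := by
      rw [hD, Finset.filter_filter, leg]
    have hsum : v * δ (swap x y) * W * b =
        v * W * b + (leg cell E x).card • -(v * δ (swap x y) * W * b) := by
      conv_lhs => rw [← hv.garnir y hyE _ hyc]
      rw [Finset.mul_sum, Finset.sum_mul, Finset.sum_mul, Finset.sum_mul,
        Finset.sum_congr rfl hterm, Finset.sum_add_distrib, Finset.sum_ite_eq' D x, if_pos hxD,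
        ← Finset.sum_filter, hleg, Finset.sum_const]
    rw [add_smul, one_smul, Nat.cast_smul_eq_nsmul]
    nth_rewrite 2 [hsum]
    rw [smul_neg]
    abel
  have hexp : v * rowSum cell (insert x F) * b =
      v * W * b + ∑ y ∈ arm cell E x, v * δ (swap x y) * W * b := by
    rw [hins, add_mul, one_mul, mul_add, add_mul]
    simp only [Finset.sum_mul, Finset.mul_sum, mul_assoc]
  rw [hexp, smul_add, Finset.smul_sum, Finset.sum_congr rfl key, Finset.sum_const,
    ← Nat.cast_smul_eq_nsmul ℚ, ← add_smul]
  congr 1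
  ring

/-- Adding one cell to the column antisymmetrizer. -/
theorem IsColAlt.mul_colSum_insert {cell : A → ℕ × ℕ} {E F : Finset A}
    {v : MonoidAlgebra ℚ (Perm A)} (hv : IsColAlt cell E v) {x : A} (hx : x ∈ E)
    (hF : ∀ y, y ∈ F ↔ y ∈ E ∧ ((cell x).2 < (cell y).2 ∨
      (cell y).2 = (cell x).2 ∧ (cell x).1 < (cell y).1)) :
    v * colSum cell (insert x F) = (((leg cell E x).card : ℚ) + 1) • (v * colSum cell F) := by
  have hxF : x ∉ F := by rw [hF]; omega
  have hfl : F.filter (fun y => (cell y).2 = (cell x).2) = leg cell E x := by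
    ext y
    simp only [Finset.mem_filter, hF, leg]
    constructor
    · rintro ⟨⟨h1, h2⟩, h3⟩; exact ⟨h1, h3, by omega⟩
    · rintro ⟨h1, h2, h3⟩; exact ⟨⟨h1, Or.inr ⟨h2, h3⟩⟩, h2⟩
  rw [colSum, charSum_insert _ _ hxF, hfl, ← colSum, ← mul_assoc, mul_add, mul_one,
    Finset.mul_sum, Finset.sum_congr rfl (g := fun _ => v), Finset.sum_const,
    ← Nat.cast_smul_eq_nsmul ℚ, add_mul, smul_mul_assoc, add_smul, one_smul, add_comm]
  intro y hy
  obtain ⟨hyE, hyc, hyr⟩ := Finset.mem_filter.1 hy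
  have hxy : x ≠ y := by rintro rfl; omega
  rw [Perm.sign_swap hxy, mul_smul_comm, hv x hx y hyE hxy hyc.symm]
  simp

/-- Induction over a finite set in increasing order of an injective key. -/
theorem finset_induction_initial {B α : Type*} [DecidableEq B] [LinearOrder α] {E : Finset B}
    (key : B → α) (hkey : Function.Injective key) {motive : Finset B → Prop} (h0 : motive ∅)
    (hs : ∀ x ∈ E, ∀ F : Finset B, (∀ y, y ∈ F ↔ y ∈ E ∧ key y < key x) → x ∉ F →
      motive F → motive (insert x F)) : motive E := by
  suffices h : ∀ s : Finset B, s ⊆ E → (∀ x ∈ s, ∀ y ∈ E, key y < key x → y ∈ s) → motive s from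
    h E subset_rfl fun _ _ y hy _ => hy
  intro s
  induction s using Finset.induction_on_max_value key with
  | empty => exact fun _ _ => h0
  | insert a s ha hmax ih =>
    intro hsub hcl
    have hlt : ∀ x ∈ s, key x < key a := fun x hx =>
      (hmax x hx).lt_of_ne fun h => ha (hkey h ▸ hx)
    have hmem : ∀ y, y ∈ s ↔ y ∈ E ∧ key y < key a := by
      intro y
      refine ⟨fun hy => ⟨hsub (Finset.mem_insert_of_mem hy), hlt y hy⟩, fun ⟨hyE, hya⟩ => ?_⟩
      refine (Finset.mem_insert.1 (hcl a (Finset.mem_insert_self a s) y hyE hya)).resolve_left ?_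
      rintro rfl
      exact lt_irrefl _ hya
    refine hs a (hsub (Finset.mem_insert_self a s)) s hmem ha (ih ?_ ?_)
    · exact (Finset.subset_insert a s).trans hsub
    · exact fun x hx y hy hyx => (hmem y).2 ⟨hy, hyx.trans (hlt x hx)⟩

/-- The product of the hook lengths of `E`, computed from arms and legs. -/
def hookProduct (cell : A → ℕ × ℕ) (E : Finset A) : ℕ :=
  ∏ x ∈ E, ((leg cell E x).card + (arm cell E x).card + 1)

/-- A vector satisfying the Garnir relations on `E` is an eigenvector of the Young symmetrizer of
`E`, and the eigenvalue is the product of the hook lengths. -/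
theorem IsGarnir.mul_rowSum_mul_colSum {cell : A → ℕ × ℕ} (hc : Function.Injective cell)
    {E : Finset A} (hd : IsDiagram cell E) {v : MonoidAlgebra ℚ (Perm A)}
    (hv : IsGarnir cell E v) :
    v * rowSum cell E * colSum cell E = (hookProduct cell E : ℚ) • v := by
  have hrow : (∏ x ∈ E, (((leg cell E x).card : ℚ) + 1)) •
      (v * rowSum cell E * colSum cell E) =
      (∏ x ∈ E, (((leg cell E x).card : ℚ) + (arm cell E x).card + 1)) •
        (v * colSum cell E) := by
    refine finset_induction_initial (E := E) (motive := fun F => (∏ x ∈ F,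
      (((leg cell E x).card : ℚ) + 1)) • (v * rowSum cell F * colSum cell E) =
      (∏ x ∈ F, (((leg cell E x).card : ℚ) + (arm cell E x).card + 1)) • (v * colSum cell E))
      (fun a => toLex (OrderDual.toDual (cell a).2, (cell a).1)) ?_ ?_ ?_
    · intro x y hxy
      simp only [EmbeddingLike.apply_eq_iff_eq, Prod.mk.injEq] at hxy
      exact hc (Prod.ext hxy.2 hxy.1)
    · simp [rowSum, charSum_empty]
    · intro x hx F hF hxF ih
      rw [Finset.prod_insert hxF, Finset.prod_insert hxF, mul_comm, mul_smul,
        hv.mul_rowSum_insert_mul_colSum hc hd hx, smul_comm, ih, mul_smul]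
      intro y
      simp [hF, Prod.Lex.toLex_lt_toLex]
  have hcol : v * colSum cell E = (∏ x ∈ E, (((leg cell E x).card : ℚ) + 1)) • v := by
    refine finset_induction_initial (E := E) (motive := fun F => v * colSum cell F = (∏ x ∈ F,
      (((leg cell E x).card : ℚ) + 1)) • v)
      (fun a => toLex (OrderDual.toDual (cell a).2, OrderDual.toDual (cell a).1)) ?_ ?_ ?_
    · intro x y hxy
      simp only [EmbeddingLike.apply_eq_iff_eq, Prod.mk.injEq] at hxy
      exact hc (Prod.ext hxy.2 hxy.1)
    · simp [colSum, charSum_empty]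
    · intro x hx F hF hxF ih
      rw [Finset.prod_insert hxF, hv.alt.mul_colSum_insert hx, ih, mul_smul]
      intro y
      simp [hF, Prod.Lex.toLex_lt_toLex]
  rw [hcol, smul_comm] at hrow
  have hne : (∏ x ∈ E, (((leg cell E x).card : ℚ) + 1)) ≠ 0 :=
    Finset.prod_ne_zero_iff.2 fun x _ => by positivity
  rw [smul_right_injective _ hne hrow, hookProduct]
  push_cast
  rfl

/-! ### Sums of transpositions -/

/-- The number of elements of `P` in column `t`. -/
def colCount (cell : A → ℕ × ℕ) (P : Finset A) (t : ℕ) : ℕ :=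
  (P.filter fun q => (cell q).2 = t).card

/-- Each element of `P` contributes twice the number of columns to its left, minus the number of
other elements of `P` in its own column. If `P` is a Young diagram, this is twice the sum of its
contents. -/
def weight (cell : A → ℕ × ℕ) (P : Finset A) : ℚ :=
  ∑ p ∈ P, (2 * ((cell p).2 : ℚ) + 1 - colCount cell P (cell p).2)

/-- The sum of the transpositions of ordered pairs of distinct elements of `P`; each transposition
occurs twice. -/
noncomputable def transSum (P : Finset A) : MonoidAlgebra ℚ (Perm A) :=
  ∑ p ∈ P, ∑ q ∈ P.erase p, δ (swap p q)

/-- The defect of the Garnir relation that exchanges `p` with the entries of `P` in column `t`. -/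
noncomputable def defect (cell : A → ℕ × ℕ) (P : Finset A) (v : MonoidAlgebra ℚ (Perm A))
    (p : A) (t : ℕ) : MonoidAlgebra ℚ (Perm A) :=
  v - v * ∑ q ∈ P with (cell q).2 = t, δ (swap p q)

theorem IsColAlt.mul_transSum {B : Type*} [DecidableEq B] {cell : B → ℕ × ℕ} {P : Finset B}
    {v : MonoidAlgebra ℚ (Perm B)} (hv : IsColAlt cell P v) :
    v * transSum P = weight cell P • v -
      (2 : ℚ) • ∑ p ∈ P, ∑ t ∈ Finset.range (cell p).2, defect cell P v p t := by
  have hsplit : ∀ p ∈ P, ∑ q ∈ P.erase p, v * δ (swap p q) =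
      (∑ q ∈ P with (cell q).2 < (cell p).2, v * δ (swap p q)) +
      (∑ q ∈ P with (cell p).2 < (cell q).2, v * δ (swap p q)) +
      (1 - (colCount cell P (cell p).2 : ℚ)) • v := by
    intro p hp
    have h3 : ∑ q ∈ (P.erase p).filter (fun q => (cell q).2 = (cell p).2), v * δ (swap p q) =
        (1 - (colCount cell P (cell p).2 : ℚ)) • v := by
      rw [Finset.sum_congr rfl (g := fun _ => -v), Finset.sum_const, ← Nat.cast_smul_eq_nsmul ℚ,
        smul_neg, ← neg_smul, Finset.filter_erase, Finset.card_erase_of_mem (by simp [hp]),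
        colCount, Nat.cast_sub]
      · push_cast; congr 1; ring
      · exact Finset.card_pos.2 ⟨p, by simp [hp]⟩
      · intro q hq
        simp only [Finset.mem_filter, Finset.mem_erase] at hq
        exact hv p hp q hq.1.2 (Ne.symm hq.1.1) hq.2.symm
    rw [← h3, Finset.sum_filter, Finset.sum_filter, Finset.sum_filter,
      ← Finset.sum_erase (a := p) P (by simp),
      ← Finset.sum_erase (a := p) (f := fun q => if (cell p).2 < (cell q).2 then _ else _) P
        (by simp), ← Finset.sum_add_distrib, ← Finset.sum_add_distrib]
    refine Finset.sum_congr rfl fun q _ => ?_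
    rcases lt_trichotomy (cell q).2 (cell p).2 with h | h | h
    · rw [if_pos h, if_neg (by omega), if_neg (by omega), add_zero, add_zero]
    · rw [if_neg (by omega), if_neg (by omega), if_pos h, zero_add, zero_add]
    · rw [if_neg (by omega), if_pos h, if_neg (by omega), zero_add, add_zero]
  have hsymm : ∑ p ∈ P, ∑ q ∈ P with (cell p).2 < (cell q).2, v * δ (swap p q) =
      ∑ p ∈ P, ∑ q ∈ P with (cell q).2 < (cell p).2, v * δ (swap p q) := by
    simp only [Finset.sum_filter]
    rw [Finset.sum_comm]
    simp only [Equiv.swap_comm]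
  have hcol : ∀ p ∈ P, ∑ q ∈ P with (cell q).2 < (cell p).2, v * δ (swap p q) =
      ((cell p).2 : ℚ) • v - ∑ t ∈ Finset.range (cell p).2, defect cell P v p t := by
    intro p _
    simp only [defect]
    rw [Finset.sum_sub_distrib, Finset.sum_const, Finset.card_range, Nat.cast_smul_eq_nsmul,
      sub_sub_cancel]
    rw [← Finset.sum_fiberwise_of_maps_to (t := Finset.range (cell p).2) (g := fun q => (cell q).2)
      (fun q hq => by simpa using (Finset.mem_filter.1 hq).2)]
    refine Finset.sum_congr rfl fun t ht => ?_
    rw [Finset.mul_sum, Finset.filter_filter]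
    refine Finset.sum_congr (Finset.filter_congr fun q _ => ?_) fun _ _ => rfl
    rw [Finset.mem_range] at ht
    omega
  rw [transSum, Finset.mul_sum]
  simp only [Finset.mul_sum]
  rw [Finset.sum_congr rfl hsplit, Finset.sum_add_distrib, Finset.sum_add_distrib, hsymm,
    Finset.sum_congr rfl hcol, weight, Finset.sum_smul, Finset.sum_sub_distrib,
    ← sub_eq_zero]
  simp only [sub_smul, add_smul, mul_smul, Finset.sum_sub_distrib, Finset.sum_add_distrib,
    ← Finset.smul_sum]
  module

/-! ### The invariant inner product -/

/-- The inner product on the group algebra for which the permutations are orthonormal. -/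
def ip (f g : MonoidAlgebra ℚ (Perm A)) : ℚ := ∑ σ, f.coeff σ * g.coeff σ

theorem ip_sub_right (f g h : MonoidAlgebra ℚ (Perm A)) : ip f (g - h) = ip f g - ip f h := by
  simp [ip, mul_sub, Finset.sum_sub_distrib]

theorem ip_neg_left (f g : MonoidAlgebra ℚ (Perm A)) : ip (-f) g = -ip f g := by
  simp [ip]

theorem ip_sum_right {κ : Type*} (s : Finset κ) (f : MonoidAlgebra ℚ (Perm A))
    (g : κ → MonoidAlgebra ℚ (Perm A)) : ip f (∑ i ∈ s, g i) = ∑ i ∈ s, ip f (g i) := by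
  simp only [ip, MonoidAlgebra.coeff_sum, Finsupp.coe_finsetSum, Finset.sum_apply, Finset.mul_sum]
  exact Finset.sum_comm

theorem ip_sum_left {κ : Type*} (s : Finset κ) (f : κ → MonoidAlgebra ℚ (Perm A))
    (g : MonoidAlgebra ℚ (Perm A)) : ip (∑ i ∈ s, f i) g = ∑ i ∈ s, ip (f i) g := by
  simp only [ip, MonoidAlgebra.coeff_sum, Finsupp.coe_finsetSum, Finset.sum_apply, Finset.sum_mul]
  exact Finset.sum_comm

theorem ip_mul_swap (f g : MonoidAlgebra ℚ (Perm A)) (x y : A) :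
    ip f (g * δ (swap x y)) = ip (f * δ (swap x y)) g := by
  simp only [ip, MonoidAlgebra.of_apply, MonoidAlgebra.coeff_mul_single_apply, mul_one,
    Equiv.swap_inv]
  refine Fintype.sum_equiv (Equiv.mulRight (swap x y)) _ _ fun σ => ?_
  simp [mul_assoc]

theorem eq_zero_of_ip_self {f : MonoidAlgebra ℚ (Perm A)} (h : ip f f = 0) : f = 0 := by
  rw [ip, Finset.sum_eq_zero_iff_of_nonneg fun _ _ => mul_self_nonneg _] at h
  ext σ
  simpa using h σ (Finset.mem_univ σ)

theorem ip_self_nonneg (f : MonoidAlgebra ℚ (Perm A)) : 0 ≤ ip f f :=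
  Finset.sum_nonneg fun _ _ => mul_self_nonneg _

/-- On column-alternating vectors the operator `1 - ∑ q, swap p q` of the Garnir relation is, up to
a positive factor, an orthogonal projection. -/
theorem IsColAlt.ip_defect {cell : A → ℕ × ℕ} {E : Finset A} {v : MonoidAlgebra ℚ (Perm A)}
    (hv : IsColAlt cell E v) {p : A} {t : ℕ} (ht : t < (cell p).2) :
    ip (defect cell E v p t) (defect cell E v p t) =
      (1 + colCount cell E t : ℚ) * ip (defect cell E v p t) v := by
  set D := E.filter fun q => (cell q).2 = t with hD
  have hanti : ∀ q ∈ D, defect cell E v p t * δ (swap p q) = -defect cell E v p t := by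
    intro q hq
    obtain ⟨hqE, hqt⟩ := Finset.mem_filter.1 hq
    have hpq : p ≠ q := by rintro rfl; omega
    have hterm : ∀ r ∈ D.erase q, v * δ (swap p r) * δ (swap p q) = -(v * δ (swap p r)) := by
      intro r hr
      obtain ⟨hrq, hrD⟩ := Finset.mem_erase.1 hr
      obtain ⟨hrE, hrt⟩ := Finset.mem_filter.1 hrD
      have hpr : p ≠ r := by rintro rfl; omega
      rw [mul_assoc, ← map_mul, Equiv.mul_swap_eq_swap_mul, Equiv.swap_apply_left,
        Equiv.swap_apply_of_ne_of_ne hpq.symm hrq.symm, map_mul, ← mul_assoc,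
        hv r hrE q hqE hrq (hrt.trans hqt.symm), neg_mul]
    rw [defect, ← hD, ← Finset.add_sum_erase _ _ hq, mul_add, sub_mul, add_mul, mul_assoc v,
      ← map_mul, Equiv.swap_mul_self, map_one, mul_one, Finset.mul_sum, Finset.sum_mul,
      Finset.sum_congr rfl hterm, Finset.sum_neg_distrib]
    abel
  set Y := defect cell E v p t with hY
  nth_rewrite 2 [hY]
  rw [defect, ← hD, ip_sub_right, Finset.mul_sum, ip_sum_right,
    Finset.sum_congr rfl (g := fun _ => -ip Y v), Finset.sum_const, colCount, ← hD,
    ← Nat.cast_smul_eq_nsmul ℚ, smul_eq_mul]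
  · ring
  · intro q hq
    rw [ip_mul_swap, hanti q hq, ip_neg_left]

/-- A column-alternating eigenvector of the transposition sum with the extreme eigenvalue satisfies
the Garnir relations: by `IsColAlt.mul_transSum` the defects sum to zero, and each of them has a
nonnegative inner product with `v`. -/
theorem IsColAlt.isGarnir {cell : A → ℕ × ℕ} {E : Finset A} {v : MonoidAlgebra ℚ (Perm A)}
    (hv : IsColAlt cell E v) (h : v * transSum E = weight cell E • v) : IsGarnir cell E v := by
  have hsum : ∑ p ∈ E, ∑ t ∈ Finset.range (cell p).2, defect cell E v p t = 0 := by
    rw [hv.mul_transSum, sub_eq_self] at h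
    exact (smul_eq_zero.1 h).resolve_left two_ne_zero
  have hnn : ∀ p, ∀ t ∈ Finset.range (cell p).2, 0 ≤ ip (defect cell E v p t) v := by
    intro p t ht
    have h1 := hv.ip_defect (Finset.mem_range.1 ht)
    have h2 := ip_self_nonneg (defect cell E v p t)
    rw [h1] at h2
    exact nonneg_of_mul_nonneg_right h2 (by positivity)
  have hip : ∑ p ∈ E, ∑ t ∈ Finset.range (cell p).2, ip (defect cell E v p t) v = 0 := by
    simp only [← ip_sum_left, hsum]
    simp [ip]
  refine ⟨hv, fun y hy t ht => ?_⟩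
  rw [Finset.sum_eq_zero_iff_of_nonneg fun p _ => Finset.sum_nonneg (hnn p)] at hip
  have h0 := (Finset.sum_eq_zero_iff_of_nonneg (hnn y)).1 (hip y hy) t (Finset.mem_range.2 ht)
  have h1 := hv.ip_defect ht
  rw [h0, mul_zero] at h1
  exact (sub_eq_zero.1 (eq_zero_of_ip_self h1)).symm

/-! ### Permutations moving entries to the left -/

/-- Membership in `leftPerms`, in terms of positions: each entry in `E` stays in place or moves to
a column strictly to the left, and the identity is the only member fixing all of `E`. -/
def IsLeft (cell : A → ℕ × ℕ) (E : Finset A) (σ : Perm A) : Prop :=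
  (∀ s ∈ E, σ s = s ∨ (cell (σ s)).2 < (cell s).2) ∧ ((∀ s ∈ E, σ s = s) → σ = 1)

theorem isLeft_one (cell : A → ℕ × ℕ) (E : Finset A) : IsLeft cell E 1 :=
  ⟨fun _ _ => Or.inl rfl, fun _ => rfl⟩

/-- The pairs `(p, q)` of positions such that `p` is occupied by an entry from `E`, `q` is not, and
`q` lies in a column to the left of `p`, when `σ` sends each entry to its position. -/
def leftMoves (cell : A → ℕ × ℕ) (E : Finset A) (σ : Perm A) : Finset (A × A) :=
  Finset.univ.filter fun x => (cell x.2).2 < (cell x.1).2 ∧ σ⁻¹ x.1 ∈ E ∧ σ⁻¹ x.2 ∉ E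

/-- The pairs `(p, q)` for which some left move from `p` to `q` leads to `τ`, namely the one from
`swap p q * τ`. -/
def backMoves (cell : A → ℕ × ℕ) (E : Finset A) (τ : Perm A) : Finset (A × A) :=
  Finset.univ.filter fun x => (cell x.2).2 < (cell x.1).2 ∧ τ⁻¹ x.2 ∈ E ∧ τ⁻¹ x.1 ∉ E

theorem mem_backMoves {cell : A → ℕ × ℕ} {E : Finset A} {τ : Perm A} {x : A × A} :
    x ∈ backMoves cell E τ ↔ (cell x.2).2 < (cell x.1).2 ∧ τ⁻¹ x.2 ∈ E ∧ τ⁻¹ x.1 ∉ E := by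
  simp [backMoves]

theorem mem_leftMoves {cell : A → ℕ × ℕ} {E : Finset A} {τ : Perm A} {x : A × A} :
    x ∈ leftMoves cell E τ ↔ (cell x.2).2 < (cell x.1).2 ∧ τ⁻¹ x.1 ∈ E ∧ τ⁻¹ x.2 ∉ E := by
  simp [leftMoves]

theorem mem_leftMoves_swap_mul {cell : A → ℕ × ℕ} {E : Finset A} {τ : Perm A} {x : A × A} :
    x ∈ leftMoves cell E (swap x.1 x.2 * τ) ↔ x ∈ backMoves cell E τ := by
  rw [mem_backMoves, mem_leftMoves, mul_inv_rev, Perm.mul_apply, Perm.mul_apply, Equiv.swap_inv,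
    Equiv.swap_apply_left, Equiv.swap_apply_right]

theorem mem_image_iff {E : Finset A} {σ : Perm A} {a : A} : a ∈ E.image σ ↔ σ⁻¹ a ∈ E := by
  rw [Finset.mem_image]
  constructor
  · rintro ⟨b, hb, rfl⟩; simpa using hb
  · exact fun h => ⟨_, h, by simp⟩

/-- A left move stays inside `leftPerms` and never leads to the identity. -/
theorem IsLeft.swap_mul {cell : A → ℕ × ℕ} {E : Finset A} {σ : Perm A} (h : IsLeft cell E σ)
    {x : A × A} (hx : x ∈ leftMoves cell E σ) :
    IsLeft cell E (swap x.1 x.2 * σ) ∧ swap x.1 x.2 * σ ≠ 1 := by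
  obtain ⟨p, q⟩ := x
  obtain ⟨hc, hp, hq⟩ := mem_leftMoves.1 hx
  dsimp only at hc hp hq ⊢
  have hsp : σ (σ⁻¹ p) = p := by simp
  have hmoved : (cell q).2 < (cell (σ⁻¹ p)).2 := by
    rcases h.1 _ hp with h1 | h1
    · rw [hsp] at h1; rwa [← h1]
    · rw [hsp] at h1; exact hc.trans h1
  have hq' : (swap p q * σ) (σ⁻¹ p) = q := by
    rw [Perm.mul_apply, hsp, Equiv.swap_apply_left]
  have hne : (swap p q * σ) (σ⁻¹ p) ≠ σ⁻¹ p := by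
    rw [hq']
    intro h0
    rw [← h0] at hmoved
    exact lt_irrefl _ hmoved
  refine ⟨⟨fun s hs => ?_, fun hall => absurd (hall _ hp) hne⟩, fun h1 => hne (by rw [h1]; rfl)⟩
  by_cases hs1 : σ s = p
  · right
    have : s = σ⁻¹ p := by rw [← hs1]; simp
    rw [this, hq']
    exact hmoved
  · have hs2 : σ s ≠ q := by
      rintro rfl
      exact hq (by simpa using hs)
    rw [Perm.mul_apply, Equiv.swap_apply_of_ne_of_ne hs1 hs2]
    exact h.1 s hs

theorem colCount_antitone {cell : A → ℕ × ℕ} (hc : Function.Injective cell) {E : Finset A}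
    (hd : IsDiagram cell E) : Antitone (colCount cell E) := by
  intro t u htu
  rw [colCount, colCount]
  have hex : ∀ a ∈ E.filter (fun q => (cell q).2 = u), ∃ b ∈ E, cell b = ((cell a).1, t) := by
    intro a ha
    obtain ⟨haE, hau⟩ := Finset.mem_filter.1 ha
    exact hd a haE _ le_rfl t (by omega)
  choose! g hg using hex
  refine Finset.card_le_card_of_injOn g (fun a ha => ?_) (fun a ha b hb hab => ?_)
  · rw [Finset.mem_coe, Finset.mem_filter]
    exact ⟨(hg a ha).1, by rw [(hg a ha).2]⟩
  · have h1 := (hg a ha).2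
    rw [hab, (hg b hb).2, Prod.mk.injEq] at h1
    have ha2 := (Finset.mem_filter.1 ha).2
    have hb2 := (Finset.mem_filter.1 hb).2
    exact hc (Prod.ext h1.1.symm (ha2.trans hb2.symm))

/-- Moving entries of a Young diagram to the left strictly decreases the weight. -/
theorem IsLeft.weight_lt {cell : A → ℕ × ℕ} (hc : Function.Injective cell) {E : Finset A}
    (hd : IsDiagram cell E) {σ : Perm A} (h : IsLeft cell E σ) (h1 : σ ≠ 1) :
    weight cell (E.image σ) < weight cell E := by
  set P := E.image σ with hP
  have himg : ∀ f : A → ℚ, ∑ p ∈ P, f p = ∑ s ∈ E, f (σ s) := fun f => by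
    rw [hP, Finset.sum_image fun _ _ _ _ h => σ.injective h]
  have hle : ∀ s ∈ E, (cell (σ s)).2 ≤ (cell s).2 := fun s hs => by
    rcases h.1 s hs with h2 | h2
    · rw [h2]
    · exact h2.le
  obtain ⟨s, hs, hne⟩ : ∃ s ∈ E, σ s ≠ s := by
    by_contra! hcon
    exact h1 (h.2 hcon)
  have hcols : ∑ p ∈ P, ((cell p).2 : ℚ) < ∑ s ∈ E, ((cell s).2 : ℚ) := by
    rw [himg]
    refine Finset.sum_lt_sum (fun s hs => by exact_mod_cast hle s hs) ⟨s, hs, ?_⟩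
    exact_mod_cast (h.1 s hs).resolve_left hne
  have hcard : ∑ _p ∈ P, (1 : ℚ) = ∑ _s ∈ E, (1 : ℚ) := himg fun _ => 1
  -- Sums over positions are regrouped by columns; `M` bounds all column indices.
  obtain ⟨M, hM⟩ : ∃ M, ∀ a : A, (cell a).2 < M :=
    ⟨Finset.univ.sup (fun a => (cell a).2) + 1, fun a =>
      Nat.lt_succ_of_le (Finset.le_sup (f := fun a => (cell a).2) (Finset.mem_univ a))⟩
  have hfib : ∀ (Q : Finset A) (f : ℕ → ℚ),
      ∑ p ∈ Q, f (cell p).2 = ∑ t ∈ Finset.range M, (colCount cell Q t : ℚ) * f t := by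
    intro Q f
    rw [← Finset.sum_fiberwise_of_maps_to (t := Finset.range M) (g := fun q => (cell q).2)
      (fun q _ => Finset.mem_range.2 (hM q))]
    refine Finset.sum_congr rfl fun t _ => ?_
    rw [Finset.sum_congr rfl (g := fun _ => f t), Finset.sum_const, nsmul_eq_mul, colCount]
    intro q hq
    rw [(Finset.mem_filter.1 hq).2]
  have hmono : ∑ s ∈ E, (colCount cell E (cell s).2 : ℚ) ≤
      ∑ p ∈ P, (colCount cell E (cell p).2 : ℚ) := by
    rw [himg]
    exact Finset.sum_le_sum fun s hs => by exact_mod_cast colCount_antitone hc hd (hle s hs)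
  have hsq : 0 ≤ ∑ t ∈ Finset.range M, ((colCount cell P t : ℚ) - colCount cell E t) ^ 2 :=
    Finset.sum_nonneg fun _ _ => sq_nonneg _
  have hexp : ∑ t ∈ Finset.range M, ((colCount cell P t : ℚ) - colCount cell E t) ^ 2 =
      ∑ p ∈ P, (colCount cell P (cell p).2 : ℚ) + ∑ s ∈ E, (colCount cell E (cell s).2 : ℚ) -
        2 * ∑ p ∈ P, (colCount cell E (cell p).2 : ℚ) := by
    rw [hfib P fun t => (colCount cell P t : ℚ), hfib E fun t => (colCount cell E t : ℚ),
      hfib P fun t => (colCount cell E t : ℚ), Finset.mul_sum, ← Finset.sum_add_distrib,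
      ← Finset.sum_sub_distrib]
    exact Finset.sum_congr rfl fun t _ => by ring
  simp only [weight, Finset.sum_sub_distrib, Finset.sum_add_distrib, ← Finset.mul_sum]
  linarith

/-! ### The coefficients -/

theorem col_le_sup_col (cell : A → ℕ × ℕ) : ∀ a, (cell a).2 ≤ Finset.univ.sup fun a => (cell a).2 :=
  fun a => Finset.le_sup (f := fun a => (cell a).2) (Finset.mem_univ a)

/-- The total distance of the entries of `E`, placed by `σ`, to the last column. -/
def colDepth (cell : A → ℕ × ℕ) (E : Finset A) (σ : Perm A) : ℕ :=
  ∑ s ∈ E, ((Finset.univ.sup fun a => (cell a).2) - (cell (σ s)).2)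

theorem colDepth_swap_mul_lt {cell : A → ℕ × ℕ} {E : Finset A} {τ : Perm A} {x : A × A}
    (hx : x ∈ backMoves cell E τ) :
    colDepth cell E (swap x.1 x.2 * τ) < colDepth cell E τ := by
  obtain ⟨p, q⟩ := x
  obtain ⟨hc, hq, hp⟩ := mem_backMoves.1 hx
  dsimp only at hc hp hq ⊢
  have hval : (swap p q * τ) (τ⁻¹ q) = p := by simp
  have hlt : (Finset.univ.sup fun a => (cell a).2) - (cell ((swap p q * τ) (τ⁻¹ q))).2 <
      (Finset.univ.sup fun a => (cell a).2) - (cell (τ (τ⁻¹ q))).2 := by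
    have h1 := col_le_sup_col cell p
    have h2 : τ (τ⁻¹ q) = q := by simp
    rw [hval, h2]
    omega
  refine Finset.sum_lt_sum (fun s hs => ?_) ⟨_, hq, hlt⟩
  by_cases hs1 : τ s = q
  · have : s = τ⁻¹ q := by rw [← hs1]; simp
    rw [this]
    exact hlt.le
  · have hs2 : τ s ≠ p := by
      rintro rfl
      exact hp (by simpa using hs)
    rw [Perm.mul_apply, Equiv.swap_apply_of_ne_of_ne hs2 hs1]

open Classical in
/-- The coefficients `m_σ`, normalized to `m_1 = 1`: the solution supported on `leftPerms` of the
triangular linear system saying that `c * ∑ m_σ σ` is an eigenvector of the transposition sum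
of `E` with eigenvalue `weight cell E`. -/
noncomputable def coef (cell : A → ℕ × ℕ) (E : Finset A) (τ : Perm A) : ℚ :=
  if τ = 1 then 1
  else if IsLeft cell E τ then
    -(2 / (weight cell E - weight cell (E.image τ))) *
      ∑ x : {x // x ∈ backMoves cell E τ}, coef cell E (swap x.1.1 x.1.2 * τ)
  else 0
termination_by colDepth cell E τ
decreasing_by exact colDepth_swap_mul_lt x.2

theorem coef_one (cell : A → ℕ × ℕ) (E : Finset A) : coef cell E 1 = 1 := by
  rw [coef, if_pos rfl]

theorem coef_of_not_isLeft {cell : A → ℕ × ℕ} {E : Finset A} {τ : Perm A}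
    (h : ¬ IsLeft cell E τ) : coef cell E τ = 0 := by
  have h1 : τ ≠ 1 := by rintro rfl; exact h (isLeft_one cell E)
  rw [coef, if_neg h1, if_neg h]

theorem coef_of_isLeft {cell : A → ℕ × ℕ} {E : Finset A} {τ : Perm A}
    (h : IsLeft cell E τ) (h1 : τ ≠ 1) :
    coef cell E τ = -(2 / (weight cell E - weight cell (E.image τ))) *
      ∑ x ∈ backMoves cell E τ, coef cell E (swap x.1 x.2 * τ) := by
  rw [coef, if_neg h1, if_pos h,
    ← Finset.sum_coe_sort (backMoves cell E τ) fun x => coef cell E (swap x.1 x.2 * τ)]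

theorem isLeft_of_mem_backMoves {cell : A → ℕ × ℕ} {E : Finset A} {τ : Perm A} {x : A × A}
    (hx : x ∈ backMoves cell E τ) (h : IsLeft cell E (swap x.1 x.2 * τ)) :
    IsLeft cell E τ ∧ τ ≠ 1 := by
  have := h.swap_mul (mem_leftMoves_swap_mul.2 hx)
  rwa [← mul_assoc, Equiv.swap_mul_self, one_mul] at this

theorem coef_equation {cell : A → ℕ × ℕ} (hc : Function.Injective cell) {E : Finset A}
    (hd : IsDiagram cell E) (τ : Perm A) :
    (weight cell (E.image τ) - weight cell E) * coef cell E τ =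
      2 * ∑ x ∈ backMoves cell E τ, coef cell E (swap x.1 x.2 * τ) := by
  by_cases h : IsLeft cell E τ ∧ τ ≠ 1
  · have hne : weight cell E - weight cell (E.image τ) ≠ 0 :=
      (sub_pos.2 (h.1.weight_lt hc hd h.2)).ne'
    rw [coef_of_isLeft h.1 h.2]
    field_simp
    ring
  · have hz : ∑ x ∈ backMoves cell E τ, coef cell E (swap x.1 x.2 * τ) = 0 :=
      Finset.sum_eq_zero fun x hx => coef_of_not_isLeft fun hl => h (isLeft_of_mem_backMoves hx hl)
    rw [hz, mul_zero]
    by_cases h1 : τ = 1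
    · subst h1
      have : E.image (1 : Perm A) = E := by ext a; rw [mem_image_iff]; simp
      rw [this, sub_self, zero_mul]
    · rw [coef_of_not_isLeft fun hl => h ⟨hl, h1⟩, mul_zero]

/-- Each left move is a transposition and comes with a negative factor, so the sign of `coef` is
the sign of the permutation. -/
theorem sign_mul_coef_nonneg {cell : A → ℕ × ℕ} (hc : Function.Injective cell) {E : Finset A}
    (hd : IsDiagram cell E) (τ : Perm A) : 0 ≤ ((Perm.sign τ : ℤ) : ℚ) * coef cell E τ := by
  induction hm : colDepth cell E τ using Nat.strong_induction_on generalizing τ with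
  | _ m ih =>
    subst hm
    by_cases h1 : τ = 1
    · subst h1; simp [coef_one]
    by_cases h : IsLeft cell E τ
    · have hpos := sub_pos.2 (h.weight_lt hc hd h1)
      have hre : ((Perm.sign τ : ℤ) : ℚ) * coef cell E τ =
          2 / (weight cell E - weight cell (E.image τ)) * ∑ x ∈ backMoves cell E τ,
            ((Perm.sign (swap x.1 x.2 * τ) : ℤ) : ℚ) * coef cell E (swap x.1 x.2 * τ) := by
        rw [coef_of_isLeft h h1, neg_mul, mul_neg, ← mul_neg, ← mul_neg, ← Finset.sum_neg_distrib,
          mul_left_comm, Finset.mul_sum]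
        congr 1
        refine Finset.sum_congr rfl fun x hx => ?_
        have hx12 : x.1 ≠ x.2 := by
          intro h0
          have := (mem_backMoves.1 hx).1
          rw [h0] at this
          exact lt_irrefl _ this
        rw [Perm.sign_mul, Perm.sign_swap hx12]
        push_cast
        ring
      rw [hre]
      exact mul_nonneg (by positivity) (Finset.sum_nonneg fun x hx =>
        ih _ (colDepth_swap_mul_lt hx) _ rfl)
    · rw [coef_of_not_isLeft h, mul_zero]

theorem weight_image {cell : A → ℕ × ℕ} {ρ : Perm A} (hρ : ∀ a, (cell (ρ a)).2 = (cell a).2)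
    (P : Finset A) : weight cell (P.image ρ) = weight cell P := by
  have hcount : ∀ t, colCount cell (P.image ρ) t = colCount cell P t := fun t => by
    rw [colCount, colCount, Finset.filter_image, Finset.card_image_of_injective _ ρ.injective]
    simp only [hρ]
  simp only [weight, hcount]
  rw [Finset.sum_image fun _ _ _ _ h => ρ.injective h]
  simp only [hρ]

theorem isLeft_conj {cell : A → ℕ × ℕ} {E : Finset A} {ρ : Perm A}
    (hρ : ρ ∈ labelPerms (fun a => (cell a).2) E) {τ : Perm A} (h : IsLeft cell E τ) :
    IsLeft cell E (ρ * τ * ρ⁻¹) := by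
  have hcol := (mem_labelPerms.1 hρ).2
  have hinv := inv_mem_labelPerms hρ
  refine ⟨fun s hs => ?_, fun hall => ?_⟩
  · have hs' := apply_mem_of_mem_labelPerms hinv hs
    have hcs : (cell (ρ⁻¹ s)).2 = (cell s).2 := (mem_labelPerms.1 hinv).2 s
    rcases h.1 _ hs' with h1 | h1
    · left; simp only [Perm.mul_apply, h1]; simp
    · right; simp only [Perm.mul_apply, hcol]; omega
  · rw [h.2, mul_one, mul_inv_cancel]
    intro s hs
    have := hall (ρ s) (apply_mem_of_mem_labelPerms hρ hs)
    simpa using this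

theorem coef_conj {cell : A → ℕ × ℕ} {E : Finset A} {ρ : Perm A}
    (hρ : ρ ∈ labelPerms (fun a => (cell a).2) E) (τ : Perm A) :
    coef cell E (ρ * τ * ρ⁻¹) = coef cell E τ := by
  have hcol := (mem_labelPerms.1 hρ).2
  have hinv := inv_mem_labelPerms hρ
  have hmem : ∀ a, ρ a ∈ E ↔ a ∈ E := fun a =>
    ⟨fun h => by simpa using apply_mem_of_mem_labelPerms hinv h, apply_mem_of_mem_labelPerms hρ⟩
  have hmem' : ∀ a, ρ⁻¹ a ∈ E ↔ a ∈ E := fun a => by rw [← hmem (ρ⁻¹ a)]; simp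
  induction hm : colDepth cell E τ using Nat.strong_induction_on generalizing τ with
  | _ m ih =>
    subst hm
    by_cases h1 : τ = 1
    · subst h1; simp
    have h1' : ρ * τ * ρ⁻¹ ≠ 1 := by
      intro h0
      apply h1
      rw [mul_inv_eq_one] at h0
      exact mul_eq_left.1 h0
    by_cases h : IsLeft cell E τ
    · have hw : weight cell (E.image (ρ * τ * ρ⁻¹)) = weight cell (E.image τ) := by
        rw [← weight_image hcol (E.image τ)]
        congr 1
        ext a
        rw [mem_image_iff, mem_image_iff, mem_image_iff, mul_inv_rev, inv_inv, mul_inv_rev,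
          Perm.mul_apply, hmem, Perm.mul_apply]
      rw [coef_of_isLeft (isLeft_conj hρ h) h1', coef_of_isLeft h h1, hw]
      congr 1
      refine (Finset.sum_bij (fun x _ => (ρ x.1, ρ x.2)) ?_ ?_ ?_ ?_).symm
      · rintro ⟨p, q⟩ hx
        rw [mem_backMoves] at hx ⊢
        dsimp only at hx ⊢ hcol
        simpa [hcol, hmem, mul_assoc] using hx
      · rintro ⟨p, q⟩ _ ⟨p', q'⟩ _ h0
        simpa using h0
      · rintro ⟨p, q⟩ hx
        refine ⟨(ρ⁻¹ p, ρ⁻¹ q), ?_, by simp⟩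
        have h2 : ∀ a, (cell (ρ⁻¹ a)).2 = (cell a).2 := (mem_labelPerms.1 hinv).2
        rw [mem_backMoves] at hx ⊢
        dsimp only at hx ⊢
        rw [h2, h2]
        simpa [hmem, mul_assoc] using hx
      · rintro ⟨p, q⟩ hx
        dsimp only
        rw [← ih _ (colDepth_swap_mul_lt hx) _ rfl]
        congr 1
        dsimp only
        rw [Equiv.swap_apply_apply]
        group
    · rw [coef_of_not_isLeft h, coef_of_not_isLeft]
      intro h0
      have := isLeft_conj hinv h0
      rw [inv_inv, ← mul_assoc, ← mul_assoc, inv_mul_cancel, one_mul, mul_assoc, inv_mul_cancel,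
        mul_one] at this
      exact h this

/-! ### The product formula over the rationals -/

theorem of_mul_transSum (σ : Perm A) (E : Finset A) :
    δ σ * transSum E = transSum (E.image σ) * δ σ := by
  rw [transSum, transSum, Finset.sum_image fun _ _ _ _ h => σ.injective h, Finset.mul_sum,
    Finset.sum_mul]
  refine Finset.sum_congr rfl fun p _ => ?_
  rw [← Finset.image_erase σ.injective, Finset.sum_image fun _ _ _ _ h => σ.injective h,
    Finset.mul_sum, Finset.sum_mul]
  refine Finset.sum_congr rfl fun q _ => ?_
  rw [← map_mul, ← map_mul, Equiv.mul_swap_eq_swap_mul]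

/-- The transposition sum of `E` acts on `c * σ`, where `c` satisfies all Garnir relations, by a
scalar and by the left moves of `σ`. -/
theorem IsGarnir.mul_of_mul_transSum {cell : A → ℕ × ℕ} {c : MonoidAlgebra ℚ (Perm A)}
    (h : IsGarnir cell Finset.univ c) (E : Finset A) (σ : Perm A) :
    c * δ σ * transSum E = weight cell (E.image σ) • (c * δ σ) -
      (2 : ℚ) • ∑ x ∈ leftMoves cell E σ, c * δ (swap x.1 x.2 * σ) := by
  set P := E.image σ with hP
  have halt : IsColAlt cell P c := fun x _ y _ => h.alt x (Finset.mem_univ x) y (Finset.mem_univ y)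
  have hdef : ∀ p ∈ P, ∀ t ∈ Finset.range (cell p).2, defect cell P c p t =
      ∑ q ∈ Pᶜ with (cell q).2 = t, c * δ (swap p q) := by
    intro p _ t ht
    have hg := h.garnir p (Finset.mem_univ p) t (Finset.mem_range.1 ht)
    rw [Finset.sum_filter, ← Finset.sum_add_sum_compl P, mul_add, ← Finset.sum_filter,
      ← Finset.sum_filter] at hg
    rw [defect, sub_eq_iff_eq_add, ← Finset.mul_sum, add_comm, hg]
  have hmoves : ∑ p ∈ P, ∑ t ∈ Finset.range (cell p).2, defect cell P c p t =
      ∑ x ∈ leftMoves cell E σ, c * δ (swap x.1 x.2) := by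
    have h1 : ∀ p ∈ P, ∑ t ∈ Finset.range (cell p).2, defect cell P c p t =
        ∑ q ∈ Pᶜ with (cell q).2 < (cell p).2, c * δ (swap p q) := by
      intro p hp
      rw [Finset.sum_congr rfl (hdef p hp),
        ← Finset.sum_fiberwise_of_maps_to (s := Pᶜ.filter _) (t := Finset.range (cell p).2)
          (g := fun q => (cell q).2) (fun q hq => by simpa using (Finset.mem_filter.1 hq).2)]
      refine Finset.sum_congr rfl fun t ht => ?_
      rw [Finset.filter_filter]
      refine Finset.sum_congr (Finset.filter_congr fun q _ => ?_) fun _ _ => rfl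
      rw [Finset.mem_range] at ht
      omega
    rw [Finset.sum_congr rfl h1]
    refine (Finset.sum_finset_product' (leftMoves cell E σ) P
      (fun p => Pᶜ.filter fun q => (cell q).2 < (cell p).2)
      (f := fun p q => c * δ (swap p q)) ?_).symm
    rintro ⟨p, q⟩
    rw [mem_leftMoves, Finset.mem_filter, Finset.mem_compl, hP, mem_image_iff, mem_image_iff]
    tauto
  rw [mul_assoc, of_mul_transSum, ← mul_assoc, halt.mul_transSum, hmoves, sub_mul, smul_mul_assoc,
    smul_mul_assoc, Finset.sum_mul]
  congr 2
  refine Finset.sum_congr rfl fun x _ => ?_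
  rw [mul_assoc, ← map_mul]

/-- The element `∑ m_σ σ`, with `m_1 = 1`. -/
noncomputable def coefSum (cell : A → ℕ × ℕ) (E : Finset A) : MonoidAlgebra ℚ (Perm A) :=
  ∑ σ, coef cell E σ • δ σ

theorem IsGarnir.mul_coefSum_mul_transSum {cell : A → ℕ × ℕ} (hc : Function.Injective cell)
    {E : Finset A} (hd : IsDiagram cell E) {c : MonoidAlgebra ℚ (Perm A)}
    (h : IsGarnir cell Finset.univ c) :
    c * coefSum cell E * transSum E = weight cell E • (c * coefSum cell E) := by
  have hX : c * coefSum cell E = ∑ σ, coef cell E σ • (c * δ σ) := by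
    rw [coefSum, Finset.mul_sum]
    simp only [mul_smul_comm]
  -- The left moves out of `σ` are regrouped as back moves at their targets.
  have hreindex : ∑ σ : Perm A, coef cell E σ •
        ∑ x ∈ leftMoves cell E σ, c * δ (swap x.1 x.2 * σ) =
      ∑ τ : Perm A, (∑ x ∈ backMoves cell E τ, coef cell E (swap x.1 x.2 * τ)) • (c * δ τ) := by
    have hl : ∀ σ : Perm A, coef cell E σ •
        ∑ x ∈ leftMoves cell E σ, c * δ (swap x.1 x.2 * σ) =
        ∑ x : A × A, if x ∈ leftMoves cell E σ then
          coef cell E σ • (c * δ (swap x.1 x.2 * σ)) else 0 := fun σ => by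
      rw [Finset.smul_sum, Finset.sum_ite_mem, Finset.univ_inter]
    have hr : ∀ τ : Perm A,
        (∑ x ∈ backMoves cell E τ, coef cell E (swap x.1 x.2 * τ)) • (c * δ τ) =
        ∑ x : A × A, if x ∈ backMoves cell E τ then
          coef cell E (swap x.1 x.2 * τ) • (c * δ τ) else 0 := fun τ => by
      rw [Finset.sum_smul, Finset.sum_ite_mem, Finset.univ_inter]
    simp only [hl, hr]
    rw [Finset.sum_comm, Finset.sum_comm (γ := Perm A)]
    refine Finset.sum_congr rfl fun x _ => ?_
    rw [← Equiv.sum_comp (Equiv.mulLeft (swap x.1 x.2))]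
    refine Finset.sum_congr rfl fun τ _ => ?_
    simp only [Equiv.coe_mulLeft, mem_leftMoves_swap_mul]
    rw [← mul_assoc, Equiv.swap_mul_self, one_mul]
  rw [hX, Finset.sum_mul]
  simp only [smul_mul_assoc, h.mul_of_mul_transSum, smul_sub]
  rw [Finset.sum_sub_distrib]
  simp only [smul_comm _ (2 : ℚ)]
  rw [← Finset.smul_sum, hreindex, Finset.smul_sum, Finset.smul_sum, ← Finset.sum_sub_distrib]
  refine Finset.sum_congr rfl fun τ _ => ?_
  rw [smul_smul, smul_smul, smul_smul, ← sub_smul, ← coef_equation hc hd]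
  congr 1
  ring

theorem IsGarnir.isColAlt_mul_coefSum {cell : A → ℕ × ℕ} {E : Finset A}
    {c : MonoidAlgebra ℚ (Perm A)} (h : IsGarnir cell Finset.univ c) :
    IsColAlt cell E (c * coefSum cell E) := by
  intro x hx y hy hxy hcol
  have hρ : swap x y ∈ labelPerms (fun a => (cell a).2) E := swap_mem_labelPerms hx hy hcol
  have hcomm : coefSum cell E * δ (swap x y) = δ (swap x y) * coefSum cell E := by
    rw [coefSum, Finset.sum_mul, Finset.mul_sum]
    rw [← Equiv.sum_comp (MulAut.conj (swap x y)).toEquiv]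
    refine Finset.sum_congr rfl fun σ _ => ?_
    simp only [MulEquiv.toEquiv_eq_coe, EquivLike.coe_coe, MulAut.conj_apply]
    rw [coef_conj hρ, smul_mul_assoc, mul_smul_comm, ← map_mul, ← map_mul, inv_mul_cancel_right]
  rw [mul_assoc, hcomm, ← mul_assoc, h.alt x (Finset.mem_univ x) y (Finset.mem_univ y) hxy hcol,
    neg_mul]

/-- If `σ ≠ 1` is in `leftPerms`, then two entries in one row of `S` are sent to the same column of
`T`: otherwise, column by column, every entry of `S` would have to stay in place. Hence the
antisymmetry of `c` meets the symmetry of the row symmetrizer. -/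
theorem IsGarnir.mul_of_mul_rowSum_eq_zero {cell : A → ℕ × ℕ}
    {E : Finset A} (hd : IsDiagram cell E) {c : MonoidAlgebra ℚ (Perm A)}
    (h : IsGarnir cell Finset.univ c) {σ : Perm A} (hσ : IsLeft cell E σ) (h1 : σ ≠ 1) :
    c * δ σ * rowSum cell E = 0 := by
  obtain ⟨x, hx, y, hy, hxy, hrow, hcol⟩ : ∃ x ∈ E, ∃ y ∈ E, x ≠ y ∧
      (cell x).1 = (cell y).1 ∧ (cell (σ x)).2 = (cell (σ y)).2 := by
    by_contra! hcon
    refine h1 (hσ.2 fun s hs => ?_)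
    induction hj : (cell s).2 using Nat.strong_induction_on generalizing s with
    | _ j ih =>
      subst hj
      by_contra hne
      have hlt := (hσ.1 s hs).resolve_left hne
      obtain ⟨u, hu, hcu⟩ := hd s hs (cell s).1 le_rfl _ hlt.le
      have hu2 : (cell u).2 = (cell (σ s)).2 := by rw [hcu]
      have hfix := ih (cell u).2 (by omega) u hu rfl
      refine hcon s hs u hu ?_ (by rw [hcu]) (by rw [hfix, hu2])
      rintro rfl
      omega
  apply eq_zero_of_eq_neg
  calc c * δ σ * rowSum cell E = c * δ σ * (δ (swap x y) * rowSum cell E) := by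
        rw [swap_mul_rowSum cell hx hy hrow]
    _ = c * δ (swap (σ x) (σ y)) * δ σ * rowSum cell E := by
        rw [← mul_assoc, mul_assoc c, ← map_mul, Equiv.mul_swap_eq_swap_mul, map_mul, ← mul_assoc]
    _ = -(c * δ σ * rowSum cell E) := by
        rw [h.alt _ (Finset.mem_univ _) _ (Finset.mem_univ _) (σ.injective.ne hxy) hcol, neg_mul,
          neg_mul]

theorem IsGarnir.mul_rowSum_mul_colSum_eq {cell : A → ℕ × ℕ} (hc : Function.Injective cell)
    {E : Finset A} (hd : IsDiagram cell E) {c : MonoidAlgebra ℚ (Perm A)}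
    (h : IsGarnir cell Finset.univ c) :
    c * (rowSum cell E * colSum cell E) = (hookProduct cell E : ℚ) • (c * coefSum cell E) := by
  have hX := h.isColAlt_mul_coefSum.isGarnir (h.mul_coefSum_mul_transSum hc hd)
  rw [← hX.mul_rowSum_mul_colSum hc hd, ← mul_assoc]
  congr 1
  rw [coefSum, Finset.mul_sum, Finset.sum_mul, Finset.sum_eq_single 1]
  · rw [coef_one, one_smul, map_one, mul_one]
  · intro σ _ h1
    by_cases hσ : IsLeft cell E σ
    · rw [mul_smul_comm, smul_mul_assoc, h.mul_of_mul_rowSum_eq_zero hd hσ h1, smul_zero]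
    · rw [coef_of_not_isLeft hσ, zero_smul, mul_zero, zero_mul]
  · exact fun h0 => absurd (Finset.mem_univ _) h0

/-! ### Tableaux -/

section Tableau

variable {lam mu : YoungDiagram}

/-- The cell of `T` containing a given entry. -/
def tabCell (T : YoungTableau lam A) (a : A) : ℕ × ℕ := (T.symm a).1

/-- The entries of the subtableau of shape `mu`. -/
def subEntries (T : YoungTableau lam A) (mu : YoungDiagram) : Finset A :=
  Finset.univ.filter fun a => tabCell T a ∈ mu.cells

theorem mem_subEntries {T : YoungTableau lam A} {a : A} :
    a ∈ subEntries T mu ↔ tabCell T a ∈ mu.cells := by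
  simp [subEntries]

theorem tabCell_injective (T : YoungTableau lam A) : Function.Injective (tabCell T) :=
  fun _ _ h => T.symm.injective (Subtype.ext h)

theorem tabCell_apply (T : YoungTableau lam A) (c : {c // c ∈ lam.cells}) :
    tabCell T (T c) = c.1 := by
  simp [tabCell]

theorem subEntries_self (T : YoungTableau lam A) : subEntries T lam = Finset.univ := by
  ext a
  simp only [mem_subEntries, Finset.mem_univ, iff_true]
  exact (T.symm a).2

theorem isDiagram_subEntries (T : YoungTableau lam A) (h : mu ≤ lam) :
    IsDiagram (tabCell T) (subEntries T mu) := by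
  intro a ha i hi j hj
  have hmem : (i, j) ∈ mu := mu.up_left_mem hi hj (mem_subEntries.1 ha)
  refine ⟨T ⟨(i, j), h hmem⟩, ?_, tabCell_apply T _⟩
  rw [mem_subEntries, tabCell_apply]
  exact hmem

theorem mem_range_sub {T : YoungTableau lam A} {h : mu ≤ lam} {a : A} :
    a ∈ Set.range (T.sub h) ↔ a ∈ subEntries T mu := by
  rw [mem_subEntries]
  constructor
  · rintro ⟨c, rfl⟩
    exact (tabCell_apply T ⟨c.1, h c.2⟩).symm ▸ c.2
  · intro ha
    exact ⟨⟨tabCell T a, ha⟩, T.apply_symm_apply a⟩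

theorem mem_rowSet_sub {T : YoungTableau lam A} {h : mu ≤ lam} {a : A} {i : ℕ} :
    a ∈ (T.sub h).rowSet i ↔ a ∈ subEntries T mu ∧ (tabCell T a).1 = i := by
  constructor
  · rintro ⟨c, rfl, rfl⟩
    exact ⟨mem_range_sub.1 ⟨c, rfl⟩, congrArg Prod.fst (tabCell_apply T ⟨c.1, h c.2⟩)⟩
  · rintro ⟨ha, rfl⟩
    exact ⟨⟨tabCell T a, mem_subEntries.1 ha⟩, rfl, T.apply_symm_apply a⟩

theorem mem_colSet_sub {T : YoungTableau lam A} {h : mu ≤ lam} {a : A} {j : ℕ} :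
    a ∈ (T.sub h).colSet j ↔ a ∈ subEntries T mu ∧ (tabCell T a).2 = j := by
  constructor
  · rintro ⟨c, rfl, rfl⟩
    exact ⟨mem_range_sub.1 ⟨c, rfl⟩, congrArg Prod.snd (tabCell_apply T ⟨c.1, h c.2⟩)⟩
  · rintro ⟨ha, rfl⟩
    exact ⟨⟨tabCell T a, mem_subEntries.1 ha⟩, rfl, T.apply_symm_apply a⟩

theorem isRowPerm_sub_iff {T : YoungTableau lam A} {h : mu ≤ lam} {σ : Perm A} :
    (T.sub h).IsRowPerm σ ↔ σ ∈ labelPerms (fun a => (tabCell T a).1) (subEntries T mu) := by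
  rw [YoungTableauIn.IsRowPerm, mem_labelPerms]
  simp only [mem_range_sub, mem_rowSet_sub]
  refine and_congr_right fun hfix => ⟨fun hr a => ?_, fun hr i a ha => ⟨?_, ?_⟩⟩
  · by_cases ha : a ∈ subEntries T mu
    · exact (hr _ a ⟨ha, rfl⟩).2
    · rw [hfix a ha]
  · exact apply_mem_of_mem_labelPerms (f := fun a => (tabCell T a).1)
      (mem_labelPerms.2 ⟨hfix, hr⟩) ha.1
  · rw [hr, ha.2]

theorem isColPerm_sub_iff {T : YoungTableau lam A} {h : mu ≤ lam} {σ : Perm A} :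
    (T.sub h).IsColPerm σ ↔ σ ∈ labelPerms (fun a => (tabCell T a).2) (subEntries T mu) := by
  rw [YoungTableauIn.IsColPerm, mem_labelPerms]
  simp only [mem_range_sub, mem_colSet_sub]
  refine and_congr_right fun hfix => ⟨fun hr a => ?_, fun hr i a ha => ⟨?_, ?_⟩⟩
  · by_cases ha : a ∈ subEntries T mu
    · exact (hr _ a ⟨ha, rfl⟩).2
    · rw [hfix a ha]
  · exact apply_mem_of_mem_labelPerms (f := fun a => (tabCell T a).2)
      (mem_labelPerms.2 ⟨hfix, hr⟩) ha.1
  · rw [hr, ha.2]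

theorem mem_leftPerms_sub_iff {T : YoungTableau lam A} {h : mu ≤ lam} {σ : Perm A} :
    σ ∈ leftPerms T (T.sub h) ↔ IsLeft (tabCell T) (subEntries T mu) σ := by
  simp only [leftPerms, Set.mem_ofPred_eq, mem_range_sub, IsLeft]
  rfl

theorem youngSymmetrizer_sub (K : Type*) [Field K] [CharZero K] (T : YoungTableau lam A)
    (h : mu ≤ lam) :
    (T.sub h).youngSymmetrizer K = MonoidAlgebra.mapRingHom (Perm A) (algebraMap ℚ K)
      (rowSum (tabCell T) (subEntries T mu) * colSum (tabCell T) (subEntries T mu)) := by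
  rw [YoungTableauIn.youngSymmetrizer, map_mul]
  congr 1
  · rw [YoungTableauIn.rowSymmetrizer, rowSum, charSum, map_sum]
    refine Finset.sum_congr ?_ fun σ _ => ?_
    · ext σ; simp [isRowPerm_sub_iff]
    · simp
  · rw [YoungTableauIn.colAntisymmetrizer, colSum, charSum, map_sum]
    refine Finset.sum_congr ?_ fun σ _ => ?_
    · ext σ; simp [isColPerm_sub_iff]
    · simp

theorem toEmbedding_eq_sub (T : YoungTableau lam A) : T.toEmbedding = T.sub le_rfl := rfl

theorem hookProduct_subEntries (T : YoungTableau lam A) (h : mu ≤ lam) :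
    hookProduct (tabCell T) (subEntries T mu) = mu.hookProd := by
  have hex : ∀ c ∈ mu.cells, ∃ a ∈ subEntries T mu, tabCell T a = c := fun c hc =>
    ⟨T ⟨c, h hc⟩, by rw [mem_subEntries, tabCell_apply]; exact hc, tabCell_apply T _⟩
  rw [hookProduct, YoungDiagram.hookProd]
  refine Finset.prod_bij (fun a _ => tabCell T a) (fun a ha => mem_subEntries.1 ha)
    (fun a _ b _ hab => tabCell_injective T hab) (fun c hc => ?_) fun x hx => ?_
  · obtain ⟨a, ha, hac⟩ := hex c hc
    exact ⟨a, ha, hac⟩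
  · have hdisj : Disjoint (leg (tabCell T) (subEntries T mu) x)
        (arm (tabCell T) (subEntries T mu) x) := by
      refine Finset.disjoint_left.2 fun y hy hy' => ?_
      have h1 := (Finset.mem_filter.1 hy).2
      have h2 := (Finset.mem_filter.1 hy').2
      omega
    have hxn : x ∉ leg (tabCell T) (subEntries T mu) x ∪ arm (tabCell T) (subEntries T mu) x := by
      simp [leg, arm]
    rw [← Finset.card_union_of_disjoint hdisj, ← Finset.card_insert_of_notMem hxn]
    rw [← Finset.card_image_of_injective _ (tabCell_injective T)]
    congr 1
    ext c
    simp only [Finset.mem_image, YoungDiagram.hook, Finset.mem_filter]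
    constructor
    · rintro ⟨y, hy, rfl⟩
      rcases Finset.mem_insert.1 hy with rfl | hy
      · exact ⟨mem_subEntries.1 hx, Or.inl ⟨rfl, le_rfl⟩⟩
      · rcases Finset.mem_union.1 hy with hy | hy <;> obtain ⟨h1, h2, h3⟩ := Finset.mem_filter.1 hy
        · exact ⟨mem_subEntries.1 h1, Or.inr ⟨h2, h3.le⟩⟩
        · exact ⟨mem_subEntries.1 h1, Or.inl ⟨h2, h3.le⟩⟩
    · rintro ⟨hc, hh⟩
      obtain ⟨y, hy, rfl⟩ := hex c hc
      refine ⟨y, ?_, rfl⟩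
      by_cases hyx : y = x
      · rw [hyx]; exact Finset.mem_insert_self _ _
      · have hne : ¬ ((tabCell T y).1 = (tabCell T x).1 ∧ (tabCell T y).2 = (tabCell T x).2) :=
          fun h0 => hyx (tabCell_injective T (Prod.ext h0.1 h0.2))
        simp only [Finset.mem_insert, Finset.mem_union, leg, arm, Finset.mem_filter, hy, true_and]
        omega

end Tableau

end YoungProduct

open Classical in
theorem theorem1 (K : Type*) [Field K] [CharZero K] (n k : ℕ) (hk : 0 < k) (hkn : k ≤ n)
    (lam mu : YoungDiagram) (hlam : lam.card = n) (hmu : mu.card = k) (hsub : mu ≤ lam)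
    (T : YoungTableau lam (Fin n)) :
    ∃ m : Equiv.Perm (Fin n) → ℚ,
      YoungTableauIn.youngSymmetrizer K T.toEmbedding *
          YoungTableauIn.youngSymmetrizer K (T.sub hsub) =
        YoungTableauIn.youngSymmetrizer K T.toEmbedding *
          ∑ σ : Equiv.Perm (Fin n) with σ ∈ leftPerms T (T.sub hsub),
            MonoidAlgebra.single σ ((m σ : ℚ) : K) ∧
      m 1 = (mu.hookProd : ℚ) ∧
      (∀ σ ∈ leftPerms T (T.sub hsub), Equiv.Perm.sign σ = 1 → 0 ≤ m σ) ∧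
      (∀ σ ∈ leftPerms T (T.sub hsub), Equiv.Perm.sign σ = -1 → m σ ≤ 0) := by
  have hinj := YoungProduct.tabCell_injective T
  have hd := YoungProduct.isDiagram_subEntries T hsub
  have hc := YoungProduct.isGarnir_rowSum_mul_colSum
    (YoungProduct.subEntries_self T ▸ YoungProduct.isDiagram_subEntries T le_rfl)
  have hmain := hc.mul_rowSum_mul_colSum_eq hinj hd
  have hsign := YoungProduct.sign_mul_coef_nonneg hinj hd
  set m := YoungProduct.coef (YoungProduct.tabCell T) (YoungProduct.subEntries T mu) with hm
  refine ⟨fun σ => mu.hookProd * m σ, ?_, ?_, fun σ _ h1 => ?_, fun σ _ h1 => ?_⟩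
  · rw [YoungProduct.toEmbedding_eq_sub, YoungProduct.youngSymmetrizer_sub,
      YoungProduct.youngSymmetrizer_sub, YoungProduct.subEntries_self, ← map_mul, hmain,
      ← mul_smul_comm, map_mul, YoungProduct.hookProduct_subEntries T hsub]
    congr 1
    rw [YoungProduct.coefSum, Finset.smul_sum, map_sum, Finset.sum_filter]
    refine Finset.sum_congr rfl fun σ _ => ?_
    rw [YoungProduct.mem_leftPerms_sub_iff]
    split_ifs with h
    · simp [hm]
    · rw [YoungProduct.coef_of_not_isLeft h, zero_smul, smul_zero, map_zero]
  · simp [hm, YoungProduct.coef_one]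
  · have := hsign σ
    rw [h1] at this
    simp only [Units.val_one, Int.cast_one, one_mul] at this
    positivity
  · have := hsign σ
    rw [h1] at this
    simp only [Units.val_neg, Units.val_one, Int.cast_neg, Int.cast_one, neg_mul, one_mul] at this
    exact mul_nonpos_of_nonneg_of_nonpos (by positivity) (by linarith)
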